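/- Let $K:\mathbb{R}^2\to\mathbb{R}$ be measurable and locally bounded, with $K\le 0$ and $K$ not almost everywhere equal to $0$. For $p\ge 1$ put $$\alpha_p(K)=\sup\Big\{a\in\mathbb{R}:\ \int_{\mathbb{R}^2}|K(x)|^p(1+|x|)^{2ap+2(p-1)}\,dx<+\infty\Big\}\in[-\infty,+\infty],\qquad \sup\emptyset=-\infty .$$ Assume that $\alpha_1(K)>0$ and that there exists $p>1$ with $\alpha_p(K)>-\infty$. Then for every real $\alpha\in(0,\alpha_1(K))$ the equation $$\Delta u+K(x)e^{2u}=0\quad\text{in }\mathbb{R}^2$$ has exactly one continuous solution $u_\alpha$ (in the sense of distributions) satisfying $u_\alpha(x)=\alpha\ln|x|+O(1)$ as $|x|\to\infty$. Moreover, $Ke^{2u_\alpha}\in L^1(\mathbb{R}^2)$ and the total curvature is $$\int_{\mathbb{R}^2}K e^{2u_\alpha}\,dx=-2\alpha\pi,$$ and there exists $c_\alpha\in\mathbb{R}$ such that for every $\beta\in(0,\alpha_1(K)-\alpha)$, $$u_\alpha(x)=\alpha\ln|x|+c_\alpha+o\Big(|x|^{-\frac{2\beta}{1+2\beta}}\Big)\quad\text{as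 }|x|\to\infty .$$ -/

import Mathlib

open MeasureTheory Filter Asymptotics
open scoped ContDiff

/-- The Euclidean plane. -/
abbrev Plane : Type := EuclideanSpace ℝ (Fin 2)

/-- `alphaExp K p` is `α_p(K)`: the supremum, in `[-∞, +∞]`, of the real numbers `a` with
`∫ |K(x)|^p (1 + |x|)^(2 a p + 2 (p - 1)) dx < +∞`; the supremum of the empty set is `-∞`. -/
noncomputable def alphaExp (K : Plane → ℝ) (p : ℝ) : EReal :=
  sSup ((fun a : ℝ => (a : EReal)) ''
    {a : ℝ | ∫⁻ x : Plane,
      ENNReal.ofReal (|K x| ^ p * (1 + ‖x‖) ^ (2 * a * p + 2 * (p - 1))) < ⊤})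

/-- Local (essential) boundedness: `K` is bounded, up to a null set, on every ball. -/
def IsLocBounded (K : Plane → ℝ) : Prop :=
  ∀ R : ℝ, ∃ C : ℝ, ∀ᵐ x : Plane, ‖x‖ ≤ R → |K x| ≤ C

/-- `u` is a continuous solution of `Δu + K e^{2u} = 0` in the plane, in the sense of
distributions. For measurable, locally bounded `K` both integrands are integrable. -/
structure IsCurvatureSolution (K u : Plane → ℝ) : Prop where
  continuous : Continuous u
  weak : ∀ φ : Plane → ℝ, ContDiff ℝ ∞ φ → HasCompactSupport φ →
    (∫ x, u x * Laplacian.laplacian φ x) + ∫ x, K x * Real.exp (2 * u x) * φ x = 0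

/-- `u(x) = α ln |x| + O(1)` as `|x| → ∞`. -/
def HasLogGrowth (α : ℝ) (u : Plane → ℝ) : Prop :=
  (fun x : Plane => u x - α * Real.log ‖x‖) =O[cocompact Plane] (fun _ : Plane => (1 : ℝ))

/-! The equation is turned into a fixed-point problem for a density. With `h = |K| e^{2u}`, a
solution of logarithmic growth must have the form `u = c + logPot h`: the difference `u - logPot h`
is weakly harmonic and grows at most logarithmically, so it is constant by Liouville
(`eq_of_weakly_harmonic`). Comparing growth at infinity then forces the mass of `h` to be `2πα`,
which is the curvature identity.

Existence: put `F = |K| (1+|x|)^{2α}` and look for `h = (m + g) F` with `∫ gF = 0`, where `m` gives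
`mF` the mass `2πα`. The equation reads `½ log (m + g) - logPot (gF) + b = c` with `b` bounded. The
logarithmic kernel is negative definite on mean-zero functions (`integral_log_mul_nonpos`), so once
`log` is replaced by a function with slopes in `[ε, ε⁻¹]` the left side is Lipschitz and strongly
monotone on mean-zero functions in `L²(F dx)`, and a contraction argument solves it.
`logPot_max_principle` confines `m + g` to an interval independent of `ε`, so for small `ε` the
truncation is never felt.

Uniqueness: for two solutions, `|K|(e^{2u} - e^{2v})` has mean zero and the sign of `u - v`, and the
same maximum principle applies in both directions.

Asymptotics: `logPot h` differs from `α log |x|` by `O(|x|^{-γ})` for every positive `γ < min (2β)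
1`, and `2β/(1+2β)` lies below that minimum. All potential estimates rest on `PotAdmissible`, which
`exists_potAdmissible` derives from the weighted `L¹` and `L^p` bounds on `K`. -/

/-! ### Pointwise estimates for the logarithmic kernel. -/

theorem log_one_add_le_rpow_div {s a : ℝ} (hs : 0 < s) (hs1 : s ≤ 1) (ha : 0 ≤ a) :
    Real.log (1 + a) ≤ a ^ s / s := by
  have h1 : (1 + a) ^ s ≤ 1 + a ^ s := by
    simpa using Real.rpow_add_le_add_rpow zero_le_one ha hs.le hs1
  have h2 : s * Real.log (1 + a) ≤ a ^ s := by
    rw [← Real.log_rpow (by linarith)]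
    have := Real.log_le_log (by positivity) h1
    have h3 := Real.log_le_sub_one_of_pos (x := 1 + a ^ s) (by positivity)
    linarith
  rw [le_div_iff₀ hs]; linarith

theorem log_norm_sub_log_norm_le {E : Type*} [NormedAddCommGroup E] {s : ℝ} (hs : 0 < s)
    (hs1 : s ≤ 1) {a b : E} (ha : a ≠ 0) (hb : b ≠ 0) :
    Real.log ‖a‖ - Real.log ‖b‖ ≤ s⁻¹ * (‖a - b‖ ^ s * ‖b‖ ^ (-s)) := by
  have ha' := norm_pos_iff.2 ha
  have hb' := norm_pos_iff.2 hb
  rw [← Real.log_div ha'.ne' hb'.ne']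
  have h1 : ‖a‖ / ‖b‖ ≤ 1 + ‖a - b‖ / ‖b‖ := by
    rw [div_le_iff₀ hb', add_mul, div_mul_cancel₀ _ hb'.ne']
    have := norm_add_le b (a - b)
    simp at this; linarith
  refine (Real.log_le_log (by positivity) h1).trans
    ((log_one_add_le_rpow_div hs hs1 (by positivity)).trans (le_of_eq ?_))
  rw [Real.div_rpow (norm_nonneg _) hb'.le, Real.rpow_neg hb'.le]
  field_simp

theorem abs_log_norm_sub_log_norm_le {E : Type*} [NormedAddCommGroup E] {s : ℝ} (hs : 0 < s)
    (hs1 : s ≤ 1) {a b : E} (ha : a ≠ 0) (hb : b ≠ 0) :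
    |Real.log ‖a‖ - Real.log ‖b‖| ≤ s⁻¹ * (‖a - b‖ ^ s * (‖a‖ ^ (-s) + ‖b‖ ^ (-s))) := by
  have h1 := log_norm_sub_log_norm_le hs hs1 ha hb
  have h2 := log_norm_sub_log_norm_le hs hs1 hb ha
  rw [norm_sub_rev] at h2
  have p1 : 0 ≤ s⁻¹ * (‖a - b‖ ^ s * ‖a‖ ^ (-s)) := by positivity
  have p2 : 0 ≤ s⁻¹ * (‖a - b‖ ^ s * ‖b‖ ^ (-s)) := by positivity
  rw [abs_le]; constructor <;> linarith

/-- The powers `r^s` and `r^{-s}` dominate `log r` at infinity and at zero, and `|x - y| ≤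
(1+|x|)(1+|y|)` separates the variables. The factor depending on the integration variable is exactly
`potWeight s s x y`. -/
theorem abs_log_norm_sub_le {s : ℝ} (hs : 0 < s) (x y : Plane) :
    |Real.log ‖x - y‖| ≤
      s⁻¹ * (1 + ‖x‖) ^ s * ((1 + ‖y‖) ^ s * (1 + ‖x - y‖ ^ (-s))) := by
  rcases eq_or_ne x y with rfl | hxy
  · simp; positivity
  have hr : 0 < ‖x - y‖ := norm_pos_iff.2 (sub_ne_zero.2 hxy)
  have hx : (1:ℝ) ≤ (1 + ‖x‖) ^ s := Real.one_le_rpow (by linarith [norm_nonneg x]) hs.le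
  have hy : (1:ℝ) ≤ (1 + ‖y‖) ^ s := Real.one_le_rpow (by linarith [norm_nonneg y]) hs.le
  have h1 : Real.log ‖x - y‖ ≤ s⁻¹ * ‖x - y‖ ^ s := by
    have := Real.log_le_rpow_div hr.le hs
    rwa [div_eq_inv_mul] at this
  have h2 : - Real.log ‖x - y‖ ≤ s⁻¹ * ‖x - y‖ ^ (-s) := by
    have := Real.log_le_rpow_div (inv_nonneg.2 hr.le) hs
    rwa [Real.log_inv, Real.inv_rpow hr.le, ← Real.rpow_neg hr.le, div_eq_inv_mul] at this
  have h3 : ‖x - y‖ ^ s ≤ (1 + ‖x‖) ^ s * (1 + ‖y‖) ^ s := by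
    rw [← Real.mul_rpow (by positivity) (by positivity)]
    apply Real.rpow_le_rpow hr.le _ hs.le
    have := norm_sub_le x y
    nlinarith [norm_nonneg x, norm_nonneg y, mul_nonneg (norm_nonneg x) (norm_nonneg y)]
  have h4 : 1 ≤ (1 + ‖x‖) ^ s * (1 + ‖y‖) ^ s := by nlinarith
  have hs' : 0 < s⁻¹ := by positivity
  have hn : 0 ≤ ‖x - y‖ ^ (-s) := by positivity
  have key : max (‖x - y‖ ^ s) (‖x - y‖ ^ (-s)) ≤
      (1 + ‖x‖) ^ s * (1 + ‖y‖) ^ s * (1 + ‖x - y‖ ^ (-s)) := by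
    apply max_le <;> nlinarith
  calc |Real.log ‖x - y‖| ≤ s⁻¹ * max (‖x - y‖ ^ s) (‖x - y‖ ^ (-s)) := by
        rw [abs_le']
        exact ⟨h1.trans (by gcongr; exact le_max_left _ _),
          h2.trans (by gcongr; exact le_max_right _ _)⟩
    _ ≤ s⁻¹ * ((1 + ‖x‖) ^ s * (1 + ‖y‖) ^ s * (1 + ‖x - y‖ ^ (-s))) := by gcongr
    _ = _ := by ring

/-- Source of the decay rate. If `|x - y| ≥ |x|/2` there is no singularity and exponent `γ` is used.
Otherwise `|y| ≥ |x|/2`, so a factor `|y|^γ` pays for `|x|^{-γ}` and only the small exponent `s` is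
spent on the singularity at `y = x`. -/
theorem abs_log_norm_sub_sub_log_norm_le {γ s : ℝ} (hγ : 0 < γ) (hs : 0 < s) (hγs : γ + s ≤ 1)
    {x y : Plane} (hx : x ≠ 0) (hxy : x ≠ y) :
    |Real.log ‖x - y‖ - Real.log ‖x‖| ≤
      (4 / s + 3 / γ) * ‖x‖ ^ (-γ) * ((1 + ‖y‖) ^ (γ + s) * (1 + ‖x - y‖ ^ (-s))) := by
  have hx' := norm_pos_iff.2 hx
  have hr : 0 < ‖x - y‖ := norm_pos_iff.2 (sub_ne_zero.2 hxy)
  have hyx : ‖x - y - x‖ = ‖y‖ := by rw [sub_sub_cancel_left, norm_neg]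
  have hW : ‖y‖ ^ (γ + s) ≤ (1 + ‖y‖) ^ (γ + s) :=
    Real.rpow_le_rpow (norm_nonneg _) (by linarith) (by linarith)
  have h2γ : (2:ℝ) ^ γ ≤ 2 := by
    simpa using Real.rpow_le_rpow_of_exponent_le (x := 2) (by norm_num) (show γ ≤ 1 by linarith)
  have hn : 0 ≤ ‖x - y‖ ^ (-s) := by positivity
  rcases le_or_gt (‖x‖ / 2) ‖x - y‖ with h | h
  · have h1 := abs_log_norm_sub_log_norm_le hγ (by linarith) (sub_ne_zero.2 hxy) hx
    rw [hyx] at h1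
    have h2 : ‖x - y‖ ^ (-γ) ≤ 2 * ‖x‖ ^ (-γ) := by
      calc ‖x - y‖ ^ (-γ) ≤ (‖x‖ / 2) ^ (-γ) :=
            Real.rpow_le_rpow_of_nonpos (by positivity) h (by linarith)
        _ = 2 ^ γ * ‖x‖ ^ (-γ) := by
            rw [Real.div_rpow hx'.le (by norm_num), Real.rpow_neg (by norm_num : (0:ℝ) ≤ 2)]
            field_simp
        _ ≤ _ := by gcongr
    have h3 : ‖y‖ ^ γ ≤ (1 + ‖y‖) ^ (γ + s) :=
      (Real.rpow_le_rpow (norm_nonneg _) (by linarith) hγ.le).trans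
        (Real.rpow_le_rpow_of_exponent_le (by linarith [norm_nonneg y]) (by linarith))
    calc _ ≤ _ := h1
      _ ≤ γ⁻¹ * ((1 + ‖y‖) ^ (γ + s) * (2 * ‖x‖ ^ (-γ) + ‖x‖ ^ (-γ))) := by gcongr
      _ = (0 + 3 / γ) * ‖x‖ ^ (-γ) * ((1 + ‖y‖) ^ (γ + s) * (1 + 0)) := by ring
      _ ≤ _ := by gcongr; positivity
  · have h1 := abs_log_norm_sub_log_norm_le hs (by linarith) (sub_ne_zero.2 hxy) hx
    rw [hyx] at h1
    have hy : ‖x‖ / 2 ≤ ‖y‖ := by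
      have := norm_sub_norm_le x (x - y)
      rw [sub_sub_cancel] at this; linarith
    have hy' : 0 < ‖y‖ := by linarith
    have h2 : ‖x‖ ^ (-s) ≤ ‖x - y‖ ^ (-s) :=
      Real.rpow_le_rpow_of_nonpos hr (by linarith) (by linarith)
    have h3 : ‖y‖ ^ s ≤ (1 + ‖y‖) ^ (γ + s) * (2 * ‖x‖ ^ (-γ)) := by
      have e : ‖y‖ ^ s = ‖y‖ ^ (γ + s) * ‖y‖ ^ (-γ) := by
        rw [← Real.rpow_add hy']; congr 1; ring
      rw [e]
      have : ‖y‖ ^ (-γ) ≤ 2 * ‖x‖ ^ (-γ) := by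
        calc ‖y‖ ^ (-γ) ≤ (‖x‖ / 2) ^ (-γ) :=
              Real.rpow_le_rpow_of_nonpos (by positivity) hy (by linarith)
          _ = 2 ^ γ * ‖x‖ ^ (-γ) := by
              rw [Real.div_rpow hx'.le (by norm_num), Real.rpow_neg (by norm_num : (0:ℝ) ≤ 2)]
              field_simp
          _ ≤ _ := by gcongr
      gcongr
    calc _ ≤ _ := h1
      _ ≤ s⁻¹ * ((1 + ‖y‖) ^ (γ + s) * (2 * ‖x‖ ^ (-γ)) * (‖x - y‖ ^ (-s) + ‖x - y‖ ^ (-s))) := by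
          gcongr
      _ = (4 / s + 0) * ‖x‖ ^ (-γ) * ((1 + ‖y‖) ^ (γ + s) * (0 + ‖x - y‖ ^ (-s))) := by ring
      _ ≤ _ := by gcongr <;> positivity

/-! ### Admissible densities and their logarithmic potentials. -/

/-- The weight controlling logarithmic potentials: growth of order `τ` at infinity and a
singularity of order `s` at `x`. -/
noncomputable def potWeight (τ s : ℝ) (x y : Plane) : ℝ := (1 + ‖y‖) ^ τ * (1 + ‖x - y‖ ^ (-s))

/-- A density whose integrals against the weights `potWeight τ s x` are bounded in `x`. -/
def PotAdmissible (τ s : ℝ) (h : Plane → ℝ) : Prop :=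
  AEStronglyMeasurable h volume ∧
    ∃ C, ∀ x, Integrable (fun y => potWeight τ s x y * |h y|) ∧ ∫ y, potWeight τ s x y * |h y| ≤ C

/-- The logarithmic potential of a density. -/
noncomputable def logPot (h : Plane → ℝ) (x : Plane) : ℝ :=
  (2 * Real.pi)⁻¹ * ∫ y, Real.log ‖x - y‖ * h y

theorem potWeight_nonneg (τ s : ℝ) (x y : Plane) : 0 ≤ potWeight τ s x y := by
  unfold potWeight; positivity

theorem one_le_potWeight {τ : ℝ} (hτ : 0 ≤ τ) (s : ℝ) (x y : Plane) : 1 ≤ potWeight τ s x y := by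
  unfold potWeight
  have h1 : (1:ℝ) ≤ (1 + ‖y‖) ^ τ := Real.one_le_rpow (by linarith [norm_nonneg y]) hτ
  have h2 : 0 ≤ ‖x - y‖ ^ (-s) := by positivity
  nlinarith

@[fun_prop]
theorem measurable_potWeight (τ s : ℝ) (x : Plane) : Measurable (potWeight τ s x) := by
  unfold potWeight; fun_prop

theorem potWeight_le {τ τ' s s' : ℝ} (hτ : τ' ≤ τ) (hs' : 0 ≤ s') (hs : s' ≤ s) (x y : Plane) :
    potWeight τ' s' x y ≤ 2 * potWeight τ s x y := by
  unfold potWeight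
  have h1 : (1 + ‖y‖) ^ τ' ≤ (1 + ‖y‖) ^ τ :=
    Real.rpow_le_rpow_of_exponent_le (by linarith [norm_nonneg y]) hτ
  have h2 : ‖x - y‖ ^ (-s') ≤ 1 + ‖x - y‖ ^ (-s) := by
    rcases eq_or_lt_of_le (norm_nonneg (x - y)) with h0 | h0
    · rw [← h0]
      -- On the diagonal the real power takes its default value: `1` when `s' = 0`, and `0`
      -- otherwise.
      have : (0:ℝ) ^ (-s') ≤ 1 := by
        rcases eq_or_lt_of_le hs' with h | h
        · simp [← h]
        · rw [Real.zero_rpow (by linarith)]; norm_num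
      have : 0 ≤ (0:ℝ) ^ (-s) := Real.rpow_nonneg le_rfl _
      linarith
    rcases le_total 1 ‖x - y‖ with h | h
    · have : ‖x - y‖ ^ (-s') ≤ 1 := Real.rpow_le_one_of_one_le_of_nonpos h (by linarith)
      have : 0 ≤ ‖x - y‖ ^ (-s) := by positivity
      linarith
    · have := Real.rpow_le_rpow_of_exponent_ge h0 h (show -s ≤ -s' by linarith)
      linarith
  calc _ ≤ (1 + ‖y‖) ^ τ * (2 * (1 + ‖x - y‖ ^ (-s))) := by
        gcongr
        have : 0 ≤ ‖x - y‖ ^ (-s) := by positivity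
        linarith
    _ = _ := by ring

namespace PotAdmissible

variable {τ τ' s s' γ : ℝ} {h h' k : Plane → ℝ}

theorem of_le (hh : PotAdmissible τ s h) (hk : AEStronglyMeasurable k volume) (c : ℝ)
    (hle : ∀ᵐ y, ∀ x, potWeight τ' s' x y * |k y| ≤ c * (potWeight τ s x y * |h y|)) :
    PotAdmissible τ' s' k := by
  obtain ⟨C, hC⟩ := hh.2
  refine ⟨hk, |c| * C, fun x => ?_⟩
  have h0 : ∀ y, 0 ≤ potWeight τ s x y * |h y| := fun y =>
    mul_nonneg (potWeight_nonneg _ _ _ _) (abs_nonneg _)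
  have hle' : ∀ᵐ y, potWeight τ' s' x y * |k y| ≤ |c| * (potWeight τ s x y * |h y|) := by
    filter_upwards [hle] with y hy
    exact (hy x).trans (mul_le_mul_of_nonneg_right (le_abs_self c) (h0 y))
  have hi : Integrable (fun y => potWeight τ' s' x y * |k y|) := by
    refine Integrable.mono' ((hC x).1.const_mul |c|)
      ((measurable_potWeight τ' s' x).aestronglyMeasurable.mul hk.norm) ?_
    filter_upwards [hle'] with y hy
    rwa [Real.norm_of_nonneg (mul_nonneg (potWeight_nonneg _ _ _ _) (abs_nonneg _))]
  refine ⟨hi, (integral_mono_ae hi ((hC x).1.const_mul |c|) hle').trans ?_⟩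
  rw [integral_const_mul]
  exact mul_le_mul_of_nonneg_left (hC x).2 (abs_nonneg _)

theorem mono (hh : PotAdmissible τ s h) (hτ : τ' ≤ τ) (hs' : 0 ≤ s') (hs : s' ≤ s) :
    PotAdmissible τ' s' h :=
  hh.of_le hh.1 2 (Eventually.of_forall fun y x => by
    rw [← mul_assoc]
    exact mul_le_mul_of_nonneg_right (potWeight_le hτ hs' hs x y) (abs_nonneg _))

theorem of_abs_le (hh : PotAdmissible τ s h) (hk : AEStronglyMeasurable k volume) (c : ℝ)
    (hle : ∀ᵐ y, |k y| ≤ c * |h y|) : PotAdmissible τ s k :=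
  hh.of_le hk c (by
    filter_upwards [hle] with y hy x
    calc _ ≤ potWeight τ s x y * (c * |h y|) :=
          mul_le_mul_of_nonneg_left hy (potWeight_nonneg _ _ _ _)
      _ = _ := by ring)

theorem sub (hh : PotAdmissible τ s h) (hk : PotAdmissible τ s k) :
    PotAdmissible τ s (fun y => h y - k y) := by
  obtain ⟨C, hC⟩ := hh.2
  obtain ⟨D, hD⟩ := hk.2
  refine ⟨hh.1.sub hk.1, C + D, fun x => ?_⟩
  have hle : ∀ y, potWeight τ s x y * |h y - k y| ≤
      potWeight τ s x y * |h y| + potWeight τ s x y * |k y| := fun y => by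
    rw [← mul_add]
    exact mul_le_mul_of_nonneg_left (abs_sub _ _) (potWeight_nonneg _ _ _ _)
  have hi : Integrable (fun y => potWeight τ s x y * |h y - k y|) := by
    refine Integrable.mono' ((hC x).1.add (hD x).1)
      ((measurable_potWeight τ s x).aestronglyMeasurable.mul (hh.1.sub hk.1).norm) ?_
    filter_upwards with y
    rw [Real.norm_of_nonneg (mul_nonneg (potWeight_nonneg _ _ _ _) (abs_nonneg _))]
    exact hle y
  refine ⟨hi, (integral_mono hi ((hC x).1.add (hD x).1) hle).trans ?_⟩
  have := integral_add (hC x).1 (hD x).1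
  simp only [Pi.add_apply] at this ⊢
  rw [this]
  exact add_le_add (hC x).2 (hD x).2

theorem integrable_mul (hh : PotAdmissible τ s h) {g : Plane → ℝ}
    (hg : AEStronglyMeasurable g volume) {c : ℝ} (x : Plane)
    (hle : ∀ᵐ y, |g y| ≤ c * potWeight τ s x y) : Integrable (fun y => g y * h y) := by
  obtain ⟨C, hC⟩ := hh.2
  refine Integrable.mono' ((hC x).1.const_mul c) (hg.mul hh.1) ?_
  filter_upwards [hle] with y hy
  rw [norm_mul, Real.norm_eq_abs, Real.norm_eq_abs, ← mul_assoc]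
  exact mul_le_mul_of_nonneg_right hy (abs_nonneg _)

/-- The constant depends on `h` alone, which makes every later potential estimate uniform in the
base point. -/
theorem abs_integral_mul_le (hh : PotAdmissible τ s h) : ∃ C, 0 ≤ C ∧ ∀ (g : Plane → ℝ) (c : ℝ)
    (x : Plane), 0 ≤ c → (∀ᵐ y, |g y| ≤ c * potWeight τ s x y) → ∫ y, |g y * h y| ≤ c * C := by
  obtain ⟨C, hC⟩ := hh.2
  refine ⟨|C|, abs_nonneg _, fun g c x hc hle => ?_⟩
  calc ∫ y, |g y * h y| ≤ ∫ y, c * (potWeight τ s x y * |h y|) := by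
        refine integral_mono_of_nonneg (Eventually.of_forall fun _ => abs_nonneg _)
          ((hC x).1.const_mul c) ?_
        filter_upwards [hle] with y hy
        rw [abs_mul, ← mul_assoc]
        exact mul_le_mul_of_nonneg_right hy (abs_nonneg _)
    _ ≤ c * |C| := by
        rw [integral_const_mul]
        exact mul_le_mul_of_nonneg_left ((hC x).2.trans (le_abs_self _)) hc

theorem integrable (hh : PotAdmissible τ s h) (hτ : 0 ≤ τ) : Integrable h := by
  simpa using hh.integrable_mul (g := fun _ => 1) aestronglyMeasurable_const (c := 1) 0
    (Eventually.of_forall fun y => by simpa using one_le_potWeight hτ s 0 y)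

theorem integrable_log_mul (hh : PotAdmissible s s h) (hs : 0 < s) (x : Plane) :
    Integrable (fun y => Real.log ‖x - y‖ * h y) :=
  hh.integrable_mul (Measurable.aestronglyMeasurable (by fun_prop)) x (Eventually.of_forall fun y => abs_log_norm_sub_le hs x y)

theorem integral_abs_log_mul_le (hh : PotAdmissible s s h) (hs : 0 < s) :
    ∃ C, 0 ≤ C ∧ ∀ x, ∫ y, |Real.log ‖x - y‖ * h y| ≤ C * (1 + ‖x‖) ^ s := by
  obtain ⟨C, hC0, hC⟩ := hh.abs_integral_mul_le
  refine ⟨s⁻¹ * C, by positivity, fun x => ?_⟩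
  refine (hC _ _ x (by positivity) (Eventually.of_forall fun y => abs_log_norm_sub_le hs x y)).trans
    (le_of_eq (by ring))

/-- The potential is even globally Hölder of order `s`: increments of the kernel cost `|x - x'|^s`
times singularities that the weights absorb. -/
theorem continuous_logPot (hh : PotAdmissible s s h) (hs : 0 < s) (hs1 : s ≤ 1) :
    Continuous (logPot h) := by
  obtain ⟨C, hC0, hC⟩ := hh.abs_integral_mul_le
  have key : ∀ x x', |logPot h x - logPot h x'| ≤
      (2 * Real.pi)⁻¹ * (2 * s⁻¹ * C) * ‖x - x'‖ ^ s := by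
    intro x x'
    have hne : ∀ z : Plane, ∀ᵐ y : Plane, y ≠ z := fun z => by simp [ae_iff]
    have hb : ∀ᵐ y, |Real.log ‖x - y‖ - Real.log ‖x' - y‖| ≤
        s⁻¹ * ‖x - x'‖ ^ s * ‖x - y‖ ^ (-s) + s⁻¹ * ‖x - x'‖ ^ s * ‖x' - y‖ ^ (-s) := by
      filter_upwards [hne x, hne x'] with y h1 h2
      have := abs_log_norm_sub_log_norm_le hs hs1 (sub_ne_zero.2 h1.symm) (sub_ne_zero.2 h2.symm)
      rw [sub_sub_sub_cancel_right] at this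
      linarith
    have hw : ∀ z y : Plane, |‖z - y‖ ^ (-s)| ≤ 1 * potWeight s s z y := fun z y => by
      rw [abs_of_nonneg (by positivity), one_mul, potWeight]
      have h1 : (1:ℝ) ≤ (1 + ‖y‖) ^ s := Real.one_le_rpow (by linarith [norm_nonneg y]) hs.le
      have h2 : 0 ≤ ‖z - y‖ ^ (-s) := by positivity
      nlinarith
    have hi : ∀ z, Integrable (fun y => |‖z - y‖ ^ (-s) * h y|) := fun z =>
      (hh.integrable_mul (Measurable.aestronglyMeasurable (by fun_prop)) z (Eventually.of_forall (hw z))).norm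
    have hC' : ∀ z, ∫ y, |‖z - y‖ ^ (-s) * h y| ≤ C := fun z => by
      simpa using hC _ 1 z zero_le_one (Eventually.of_forall (hw z))
    rw [logPot, logPot, ← mul_sub, ← integral_sub (hh.integrable_log_mul hs x)
      (hh.integrable_log_mul hs x'), abs_mul, abs_of_nonneg (by positivity), mul_assoc]
    gcongr
    calc _ ≤ ∫ y, |Real.log ‖x - y‖ * h y - Real.log ‖x' - y‖ * h y| := abs_integral_le_integral_abs
      _ ≤ ∫ y, (s⁻¹ * ‖x - x'‖ ^ s * |‖x - y‖ ^ (-s) * h y|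
            + s⁻¹ * ‖x - x'‖ ^ s * |‖x' - y‖ ^ (-s) * h y|) := by
          refine integral_mono_of_nonneg (Eventually.of_forall fun _ => abs_nonneg _)
            (((hi x).const_mul _).add ((hi x').const_mul _)) ?_
          filter_upwards [hb] with y hy
          rw [← sub_mul, abs_mul, abs_mul, abs_mul, abs_of_nonneg (by positivity : 0 ≤ ‖x - y‖ ^ (-s)),
            abs_of_nonneg (by positivity : 0 ≤ ‖x' - y‖ ^ (-s))]
          calc _ ≤ _ := mul_le_mul_of_nonneg_right hy (abs_nonneg _)
            _ = _ := by ring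
      _ = s⁻¹ * ‖x - x'‖ ^ s * (∫ y, |‖x - y‖ ^ (-s) * h y|)
            + s⁻¹ * ‖x - x'‖ ^ s * ∫ y, |‖x' - y‖ ^ (-s) * h y| := by
          rw [integral_add ((hi x).const_mul _) ((hi x').const_mul _), integral_const_mul,
            integral_const_mul]
      _ ≤ s⁻¹ * ‖x - x'‖ ^ s * C + s⁻¹ * ‖x - x'‖ ^ s * C := by gcongr <;> exact hC' _
      _ = _ := by ring
  rw [continuous_iff_continuousAt]
  intro x
  rw [ContinuousAt, tendsto_iff_dist_tendsto_zero]
  refine squeeze_zero (fun _ => dist_nonneg) (fun y => key y x) ?_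
  have : Tendsto (fun y => (2 * Real.pi)⁻¹ * (2 * s⁻¹ * C) * ‖y - x‖ ^ s) (nhds x)
      (nhds ((2 * Real.pi)⁻¹ * (2 * s⁻¹ * C) * ‖x - x‖ ^ s)) :=
    Continuous.tendsto (by fun_prop (disch := positivity)) x
  simpa [Real.zero_rpow hs.ne'] using this

/-- The subtracted term is the potential of the whole mass placed at the origin; the error of moving
the mass is the pointwise kernel estimate integrated against `h`. -/
theorem logPot_sub_log_le (hh : PotAdmissible (γ + s) s h) (hγ : 0 < γ) (hs : 0 < s)
    (hγs : γ + s ≤ 1) :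
    ∃ C, 0 ≤ C ∧ ∀ x, x ≠ 0 →
      |logPot h x - (2 * Real.pi)⁻¹ * (∫ y, h y) * Real.log ‖x‖| ≤ C * ‖x‖ ^ (-γ) := by
  obtain ⟨C, hC0, hC⟩ := hh.abs_integral_mul_le
  refine ⟨(2 * Real.pi)⁻¹ * ((4 / s + 3 / γ) * C), by positivity, fun x hx => ?_⟩
  have hne : ∀ᵐ y : Plane, x ≠ y := by simp [ae_iff]
  have hi1 := (hh.mono (show s ≤ γ + s by linarith) hs.le le_rfl).integrable_log_mul hs x
  have hi2 := (hh.integrable (by linarith)).const_mul (Real.log ‖x‖)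
  have e : logPot h x - (2 * Real.pi)⁻¹ * (∫ y, h y) * Real.log ‖x‖ =
      (2 * Real.pi)⁻¹ * ∫ y, (Real.log ‖x - y‖ - Real.log ‖x‖) * h y := by
    simp_rw [sub_mul]
    rw [integral_sub hi1 hi2, integral_const_mul, logPot]; ring
  rw [e, abs_mul, abs_of_nonneg (by positivity), mul_assoc]
  gcongr
  refine abs_integral_le_integral_abs.trans ((hC _ ((4 / s + 3 / γ) * ‖x‖ ^ (-γ)) x (by positivity)
    ?_).trans (le_of_eq (by ring)))
  filter_upwards [hne] with y hy
  exact abs_log_norm_sub_sub_log_norm_le hγ hs hγs hx hy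

theorem logPot_sub_log_one_add_le (hh : PotAdmissible (γ + s) s h) (hγ : 0 < γ) (hs : 0 < s)
    (hγs : γ + s ≤ 1) :
    ∃ C, ∀ x, |logPot h x - (2 * Real.pi)⁻¹ * (∫ y, h y) * Real.log (1 + ‖x‖)| ≤ C := by
  obtain ⟨C, hC0, hC⟩ := hh.logPot_sub_log_le hγ hs hγs
  set m := (2 * Real.pi)⁻¹ * ∫ y, h y
  have hc : Continuous (fun x => |logPot h x - m * Real.log (1 + ‖x‖)|) := by
    have := (hh.mono (show s ≤ γ + s by linarith) hs.le le_rfl).continuous_logPot hs (by linarith)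
    fun_prop (disch := intros; positivity)
  obtain ⟨D, hD⟩ := (isCompact_closedBall (0 : Plane) 1).bddAbove_image hc.continuousOn
  refine ⟨max D (C + |m| * Real.log 2), fun x => ?_⟩
  rcases le_total ‖x‖ 1 with h1 | h1
  · exact (hD ⟨x, by simpa using h1, rfl⟩).trans (le_max_left _ _)
  · refine le_trans ?_ (le_max_right _ _)
    have hx0 : 0 < ‖x‖ := by linarith
    have hx : x ≠ 0 := norm_pos_iff.1 hx0
    have h2 : |Real.log ‖x‖ - Real.log (1 + ‖x‖)| ≤ Real.log 2 := by
      have a1 := Real.log_le_log hx0 (show ‖x‖ ≤ 1 + ‖x‖ by linarith)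
      have a2 := Real.log_le_log (by positivity) (show 1 + ‖x‖ ≤ 2 * ‖x‖ by linarith)
      rw [Real.log_mul (by norm_num) hx0.ne'] at a2
      have := Real.log_nonneg (show (1:ℝ) ≤ 2 by norm_num)
      rw [abs_le]; constructor <;> linarith
    have h3 : ‖x‖ ^ (-γ) ≤ 1 := Real.rpow_le_one_of_one_le_of_nonpos h1 (by linarith)
    calc _ = |(logPot h x - m * Real.log ‖x‖) + m * (Real.log ‖x‖ - Real.log (1 + ‖x‖))| := by
          congr 1; ring
      _ ≤ C * ‖x‖ ^ (-γ) + |m| * |Real.log ‖x‖ - Real.log (1 + ‖x‖)| := by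
          refine (abs_add_le _ _).trans ?_
          rw [abs_mul]; gcongr; exact hC x hx
      _ ≤ C * 1 + |m| * Real.log 2 := by gcongr
      _ = _ := by ring

end PotAdmissible

/-! ### Admissibility from weighted integrability of `K`. -/

theorem integrable_indicator_ball_norm_inv :
    Integrable (fun z : Plane => if ‖z‖ < 1 then ‖z‖⁻¹ else 0) := by
  rw [integrable_fun_norm_addHaar (μ := (volume : Measure Plane))
    (f := fun r : ℝ => if r < 1 then r⁻¹ else 0)]
  have : IntegrableOn (fun r : ℝ => (Set.Ioo (0:ℝ) 1).indicator (fun _ => (1:ℝ)) r) (Set.Ioi 0) := by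
    refine Integrable.integrableOn ?_
    rw [integrable_indicator_iff measurableSet_Ioo]
    exact integrableOn_const (by simp)
  refine this.congr_fun (fun r hr => ?_) measurableSet_Ioi
  have hr' : (0:ℝ) < r := hr
  by_cases h : r < 1 <;> simp [Set.indicator, hr', h, hr'.ne']

/-- Interpolation between a weighted `L¹` and a weighted `L^p` bound, with `q = 1 + θ(p - 1)`. The
exponent `A` may be very negative; the strict gap `b < B` compensates once `θ` is small. -/
theorem rpow_interpolation_le {p A B b : ℝ} (hp : 1 < p) (hb : b < B) :
    ∃ q : ℝ, 1 < q ∧ ∀ k w : ℝ, 0 ≤ k → 1 ≤ w →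
      (k * w ^ b) ^ q ≤ k * w ^ B + k ^ p * w ^ A := by
  -- Comparing exponents of `w` requires `θ((p-1)b + B - A) ≤ B - b`; `D` bounds the bracket, and
  -- the choice of `θ` also keeps it in `(0, 1)`.
  set D := |(p - 1) * b + B - A| + 1 with hD
  have hDpos : 0 < D := by positivity
  set θ := (B - b) / (D + (B - b)) with hθ
  have hBb : 0 < B - b := by linarith
  have hθ0 : 0 < θ := by positivity
  have hθ1 : θ < 1 := by rw [hθ, div_lt_one (by positivity)]; linarith
  have hθD : θ * ((p - 1) * b + B - A) ≤ B - b := by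
    calc θ * ((p - 1) * b + B - A) ≤ θ * D := by
          gcongr; rw [hD]; linarith [le_abs_self ((p - 1) * b + B - A)]
      _ ≤ B - b := by
          rw [hθ, div_mul_eq_mul_div, div_le_iff₀ (by positivity)]
          nlinarith
  refine ⟨1 + θ * (p - 1), by nlinarith, fun k w hk hw => ?_⟩
  have hw0 : 0 < w := by linarith
  have hX : 0 ≤ k * w ^ B := by positivity
  have hY : 0 ≤ k ^ p * w ^ A := by positivity
  have h1 := Real.geom_mean_le_arith_mean2_weighted (sub_nonneg.2 hθ1.le) hθ0.le hX hY (by ring)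
  have h2 : (k * w ^ b) ^ (1 + θ * (p - 1)) ≤ (k * w ^ B) ^ (1 - θ) * (k ^ p * w ^ A) ^ θ := by
    rw [Real.mul_rpow hk (by positivity), Real.mul_rpow hk (by positivity),
      Real.mul_rpow (by positivity) (by positivity), ← Real.rpow_mul hw0.le, ← Real.rpow_mul hw0.le,
      ← Real.rpow_mul hw0.le, ← Real.rpow_mul hk]
    have e : k ^ (1 + θ * (p - 1)) = k ^ (1 - θ) * k ^ (p * θ) := by
      rw [← Real.rpow_add_of_nonneg hk (by linarith) (by positivity)]; congr 1; ring
    have e2 : w ^ (b * (1 + θ * (p - 1))) ≤ w ^ (B * (1 - θ)) * w ^ (A * θ) := by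
      rw [← Real.rpow_add hw0]
      apply Real.rpow_le_rpow_of_exponent_le hw
      nlinarith
    calc _ ≤ k ^ (1 - θ) * k ^ (p * θ) * (w ^ (B * (1 - θ)) * w ^ (A * θ)) := by rw [e]; gcongr
      _ = _ := by ring
  refine (h2.trans h1).trans ?_
  nlinarith

/-- Young's inequality separates singularity from density: for `|x - y| < 1`, `|x - y|^{-1/q'} G ≤
|x - y|^{-1} + G^q`. The first term is integrable on a disc of the plane with an integral
independent of `x`; the second is controlled by interpolation. Hence the bound is uniform in `x`. -/
theorem exists_potAdmissible {K : Plane → ℝ} (hK : AEMeasurable K volume) {p A B κ τ : ℝ}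
    (hp : 1 < p) (hKB : Integrable (fun x => |K x| * (1 + ‖x‖) ^ B))
    (hKA : Integrable (fun x => |K x| ^ p * (1 + ‖x‖) ^ A)) (hb : κ + τ < B) :
    ∃ s₀, 0 < s₀ ∧ ∀ s, 0 ≤ s → s ≤ s₀ →
      PotAdmissible τ s (fun y => |K y| * (1 + ‖y‖) ^ κ) := by
  obtain ⟨q, hq, hle⟩ := rpow_interpolation_le (A := A) hp hb
  have hqq := Real.HolderConjugate.conjExponent hq
  set q' := q.conjExponent
  have hq' := hqq.symm.pos
  have hw1 : ∀ y : Plane, 1 ≤ 1 + ‖y‖ := fun y => by linarith [norm_nonneg y]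
  suffices PotAdmissible τ q'⁻¹ (fun y => |K y| * (1 + ‖y‖) ^ κ) from
    ⟨q'⁻¹, by positivity, fun s hs hs' => this.mono le_rfl hs hs'⟩
  have hm : AEStronglyMeasurable (fun y => |K y| * (1 + ‖y‖) ^ κ) volume :=
    (hK.aestronglyMeasurable.norm).mul (Measurable.aestronglyMeasurable (by fun_prop))
  set k : Plane → ℝ := fun z => if ‖z‖ < 1 then ‖z‖⁻¹ else 0 with hk
  have hk0 : ∀ z, 0 ≤ k z := fun z => by rw [hk]; positivity
  have hkint : ∀ x, Integrable (fun y => k (x - y)) := fun x =>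
    integrable_indicator_ball_norm_inv.comp_sub_left x
  have key : ∀ x y, potWeight τ q'⁻¹ x y * (|K y| * (1 + ‖y‖) ^ κ) ≤
      3 * (|K y| * (1 + ‖y‖) ^ B) + |K y| ^ p * (1 + ‖y‖) ^ A + k (x - y) := by
    intro x y
    have hy0 : 0 < 1 + ‖y‖ := by positivity
    set G := |K y| * (1 + ‖y‖) ^ (κ + τ) with hG
    have hG0 : 0 ≤ G := by positivity
    have hGX : G ≤ |K y| * (1 + ‖y‖) ^ B := by
      rw [hG]; gcongr; exact hw1 y
    have hGq := hle |K y| (1 + ‖y‖) (abs_nonneg _) (hw1 y)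
    have hY0 : 0 ≤ |K y| ^ p * (1 + ‖y‖) ^ A := by positivity
    have e : potWeight τ q'⁻¹ x y * (|K y| * (1 + ‖y‖) ^ κ) = G + ‖x - y‖ ^ (-q'⁻¹) * G := by
      rw [potWeight, hG, Real.rpow_add hy0]; ring
    have hs : ‖x - y‖ ^ (-q'⁻¹) * G ≤ G + k (x - y) + G ^ q := by
      have hGq0 : 0 ≤ G ^ q := by positivity
      by_cases hr : ‖x - y‖ < 1
      · have h := Real.young_inequality_of_nonneg (a := ‖x - y‖ ^ (-q'⁻¹)) (b := G) (by positivity)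
          hG0 hqq.symm
        rw [← Real.rpow_mul (norm_nonneg _), neg_mul, inv_mul_cancel₀ hq'.ne', Real.rpow_neg_one] at h
        have h3 : k (x - y) = ‖x - y‖⁻¹ := by simp [hk, hr]
        have h4 : ‖x - y‖⁻¹ / q' ≤ ‖x - y‖⁻¹ := div_le_self (by positivity) hqq.symm.lt.le
        have h5 : G ^ q / q ≤ G ^ q := div_le_self hGq0 hq.le
        linarith
      · have h1 : ‖x - y‖ ^ (-q'⁻¹) ≤ 1 :=
          Real.rpow_le_one_of_one_le_of_nonpos (by linarith) (by simp [hq'.le])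
        have := hk0 (x - y)
        nlinarith
    rw [e]; linarith
  have hint : ∀ x, Integrable (fun y => 3 * (|K y| * (1 + ‖y‖) ^ B) + |K y| ^ p * (1 + ‖y‖) ^ A
      + k (x - y)) := fun x => ((hKB.const_mul 3).add hKA).add (hkint x)
  have habs : ∀ y, |(|K y| * (1 + ‖y‖) ^ κ)| = |K y| * (1 + ‖y‖) ^ κ := fun y =>
    abs_of_nonneg (by positivity)
  refine ⟨hm, 3 * (∫ y, |K y| * (1 + ‖y‖) ^ B) + (∫ y, |K y| ^ p * (1 + ‖y‖) ^ A) + ∫ z, k z,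
    fun x => ?_⟩
  simp_rw [habs]
  have hi : Integrable (fun y => potWeight τ q'⁻¹ x y * (|K y| * (1 + ‖y‖) ^ κ)) := by
    refine (hint x).mono' ((measurable_potWeight _ _ x).aestronglyMeasurable.mul hm)
      (Eventually.of_forall fun y => ?_)
    rw [Real.norm_of_nonneg (mul_nonneg (potWeight_nonneg _ _ _ _) (by positivity))]
    exact key x y
  refine ⟨hi, (integral_mono hi (hint x) (key x)).trans (le_of_eq ?_)⟩
  have h1 := integral_add ((hKB.const_mul 3).add hKA) (hkint x)
  have h2 := integral_add (hKB.const_mul 3) hKA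
  simp only [Pi.add_apply] at h1 h2
  rw [h1, h2, integral_const_mul, integral_sub_left_eq_self k volume x]

/-! ### Circle means and the maximum principle. -/

/-- The standard isometry between `ℂ` and the plane. -/
noncomputable def planeIso : ℂ ≃ₗᵢ[ℝ] Plane := Complex.orthonormalBasisOneI.repr

/-- The mean of `f` over the circle of centre `x` and radius `r`. -/
noncomputable def circMean (f : Plane → ℝ) (x : Plane) (r : ℝ) : ℝ :=
  Real.circleAverage (fun z => f (planeIso z)) (planeIso.symm x) r

/-- Fubini reduces this to the circle mean of `log |z - y|`, which is `max (log r) (log |x - y|)`.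
Averaging thus alters the kernel only inside the circle, where it raises it. -/
theorem circMean_logPot {s : ℝ} {h : Plane → ℝ} (hh : PotAdmissible s s h) (hs : 0 < s)
    (x : Plane) {r : ℝ} (hr : 0 < r) :
    Integrable (fun y => (Real.log r + Real.posLog (r⁻¹ * ‖x - y‖)) * h y) ∧
    circMean (logPot h) x r =
      (2 * Real.pi)⁻¹ * ∫ y, (Real.log r + Real.posLog (r⁻¹ * ‖x - y‖)) * h y := by
  obtain ⟨C, hC0, hC⟩ := hh.integral_abs_log_mul_le hs
  set c := planeIso.symm x with hc
  set μ := (volume : Measure ℝ).restrict (Set.Ioc 0 (2 * Real.pi)) with hμ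
  set G : ℝ → Plane → ℝ := fun θ y => Real.log ‖planeIso (circleMap c r θ) - y‖ * h y with hG
  have hb : ∀ θ, ‖planeIso (circleMap c r θ)‖ ≤ ‖c‖ + r := fun θ => by
    rw [planeIso.norm_map]
    have h1 := norm_circleMap_zero r θ
    rw [circleMap, ← circleMap_zero]
    exact (norm_add_le _ _).trans (by rw [h1, abs_of_pos hr])
  have hm : AEStronglyMeasurable (Function.uncurry G) (μ.prod volume) := by
    refine AEStronglyMeasurable.mul (Measurable.aestronglyMeasurable ?_) hh.1.comp_snd
    have : Measurable (fun p : ℝ × Plane => planeIso (circleMap c r p.1)) :=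
      (planeIso.continuous.comp ((continuous_circleMap c r).comp continuous_fst)).measurable
    fun_prop
  have hint : Integrable (Function.uncurry G) (μ.prod volume) := by
    rw [integrable_prod_iff hm]
    refine ⟨Eventually.of_forall fun θ =>
      hh.integrable_log_mul hs (planeIso (circleMap c r θ)), ?_⟩
    have hm' : AEStronglyMeasurable (fun θ => ∫ y, ‖Function.uncurry G (θ, y)‖) μ :=
      hm.norm.integral_prod_right'
    have hle : ∀ θ, ‖∫ y, ‖Function.uncurry G (θ, y)‖‖ ≤ C * (1 + (‖c‖ + r)) ^ s := fun θ => by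
      rw [Real.norm_of_nonneg (integral_nonneg fun _ => norm_nonneg _)]
      refine (hC (planeIso (circleMap c r θ))).trans ?_
      gcongr
      exact hb θ
    exact Integrable.of_bound hm' _ (Eventually.of_forall hle)
  have hin : ∀ y, ∫ θ, G θ y ∂μ =
      2 * Real.pi * ((Real.log r + Real.posLog (r⁻¹ * ‖x - y‖)) * h y) := fun y => by
    have h1 := circleAverage_log_norm_sub_const_eq_log_radius_add_posLog
      (a := planeIso.symm y) (c := c) hr.ne'
    rw [hc, ← map_sub, planeIso.symm.norm_map, ← hc, Real.circleAverage,
      intervalIntegral.integral_of_le Real.two_pi_pos.le, smul_eq_mul,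
      inv_mul_eq_iff_eq_mul₀ Real.two_pi_pos.ne'] at h1
    simp only [hG]
    rw [integral_mul_const, ← mul_assoc, ← h1]
    congr 2
    ext θ
    rw [← planeIso.norm_map, map_sub, planeIso.apply_symm_apply]
  constructor
  · have := hint.integral_prod_right
    simp only [Function.uncurry] at this
    simp_rw [hin] at this
    refine (this.const_mul (2 * Real.pi)⁻¹).congr (Eventually.of_forall fun y => ?_)
    exact inv_mul_cancel_left₀ Real.two_pi_pos.ne' _
  · have h2 := integral_integral_swap hint
    simp_rw [hin] at h2
    rw [integral_const_mul] at h2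
    rw [circMean, Real.circleAverage, intervalIntegral.integral_of_le Real.two_pi_pos.le]
    simp only [logPot]
    rw [integral_const_mul, smul_eq_mul]
    simp only [hG, hμ, hc] at h2
    rw [h2]
    field_simp

theorem eq_of_le_circMean {f : Plane → ℝ} (hf : Continuous f) {M : ℝ} (hM : ∀ x, f x ≤ M)
    {x : Plane} {r : ℝ} (h : M ≤ circMean f x r) {z : Plane} (hz : ‖z - x‖ = |r|) : f z = M := by
  by_contra hne
  set c := planeIso.symm x
  have hcont : Continuous fun θ => f (planeIso (circleMap c r θ)) :=
    hf.comp (planeIso.continuous.comp (continuous_circleMap c r))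
  have hmem : planeIso.symm z ∈ Metric.sphere c |r| := by
    rw [mem_sphere_iff_norm, ← map_sub, planeIso.symm.norm_map, hz]
  rw [← image_circleMap_Ioc] at hmem
  obtain ⟨θ, hθ, hθz⟩ := hmem
  have hpos : 0 < ∫ θ in (0:ℝ)..2 * Real.pi, (M - f (planeIso (circleMap c r θ))) := by
    refine intervalIntegral.integral_pos Real.two_pi_pos (by fun_prop)
      (fun θ _ => sub_nonneg.2 (hM _)) ⟨θ, Set.Ioc_subset_Icc_self hθ, ?_⟩
    rw [hθz, planeIso.apply_symm_apply]
    exact sub_pos.2 (lt_of_le_of_ne (hM z) hne)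
  rw [intervalIntegral.integral_sub (by simp) (hcont.intervalIntegrable _ _),
    intervalIntegral.integral_const] at hpos
  rw [circMean, Real.circleAverage, smul_eq_mul, le_inv_mul_iff₀ Real.two_pi_pos] at h
  simp only [sub_zero, smul_eq_mul] at hpos
  linarith

/-- A maximum principle: if `v = c + logPot h`, where `h` has mean zero and is nonnegative wherever
`v > B`, then `v ≤ B` unless `h = 0`. -/
theorem logPot_max_principle {γ s : ℝ} {h : Plane → ℝ} (hh : PotAdmissible (γ + s) s h)
    (hγ : 0 < γ) (hs : 0 < s) (hγs : γ + s ≤ 1) (h0 : ∫ y, h y = 0) {c B : ℝ}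
    (hpos : ∀ᵐ y, B < c + logPot h y → 0 ≤ h y) :
    (∀ x, c + logPot h x ≤ B) ∨ ∀ᵐ y, h y = 0 := by
  have hh' := hh.mono (show s ≤ γ + s by linarith) hs.le le_rfl
  have hint := hh.integrable (by linarith)
  set v : Plane → ℝ := fun x => c + logPot h x with hv
  have hvc : Continuous v := by
    have := hh'.continuous_logPot hs (by linarith)
    fun_prop
  have hmean : ∀ x r, 0 < r → circMean v x r = c + circMean (logPot h) x r := by
    intro x r hr
    rw [circMean, circMean, hv]
    have := Real.circleAverage_add (f₁ := fun _ : ℂ => c) (f₂ := fun z => logPot h (planeIso z))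
      (c := planeIso.symm x) (R := r) (circleIntegrable_const _ _ _)
      (((hh'.continuous_logPot hs (by linarith)).comp
        planeIso.continuous).continuousOn.circleIntegrable')
    rw [Real.circleAverage_const] at this
    exact this
  -- Mean zero cancels the logarithmic term, so the potential vanishes at infinity.
  have hlim : Tendsto v (cocompact Plane) (nhds c) := by
    obtain ⟨C, hC0, hC⟩ := hh.logPot_sub_log_le hγ hs hγs
    have h1 : Tendsto (fun x : Plane => C * ‖x‖ ^ (-γ)) (cocompact Plane) (nhds (C * 0)) :=
      ((tendsto_rpow_neg_atTop hγ).comp tendsto_norm_cocompact_atTop).const_mul C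
    rw [mul_zero] at h1
    have h2 : Tendsto (logPot h) (cocompact Plane) (nhds 0) := by
      refine squeeze_zero_norm' ?_ h1
      have : ∀ᶠ x in cocompact Plane, x ≠ 0 :=
        (isCompact_singleton (x := (0 : Plane))).compl_mem_cocompact
      filter_upwards [this] with x hx
      simpa [h0] using hC x hx
    simpa using h2.const_add c
  rcases em (∀ x, v x ≤ B) with hB | hB
  · exact Or.inl hB
  right
  push Not at hB
  obtain ⟨x₂, hx₂⟩ := hB
  -- The supremum is attained. If `v` exceeds its limit `c` somewhere, this is compactness.
  -- Otherwise `B < c`, so `h ≥ 0` outside a large disc; the mean over its boundary circle is then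
  -- at least `c`, which forces `v = c` there.
  obtain ⟨x₁, hx₁⟩ : ∃ x, ∀ y, v y ≤ v x := by
    by_cases hex : ∃ x, c < v x
    · obtain ⟨x, hx⟩ := hex
      exact hvc.exists_forall_ge' x ((hlim.eventually (gt_mem_nhds hx)).mono fun y hy => hy.le)
    · push Not at hex
      have hcB : B < c := hx₂.trans_le (hex x₂)
      have hev := hlim.eventually (lt_mem_nhds hcB)
      rw [Metric.cobounded_eq_cocompact.symm, ← comap_norm_atTop, eventually_comap] at hev
      obtain ⟨R, hR⟩ := (hev.and (eventually_gt_atTop 0)).exists_forall_of_atTop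
      have hR0 : 0 < R := (hR R le_rfl).2
      have hge : c ≤ circMean v 0 R := by
        rw [hmean 0 R hR0, (circMean_logPot hh' hs 0 hR0).2]
        have hi1 := hint.const_mul (Real.log R)
        have hi2 : Integrable fun y => Real.posLog (R⁻¹ * ‖(0 : Plane) - y‖) * h y := by
          refine ((circMean_logPot hh' hs 0 hR0).1.sub hi1).congr (Eventually.of_forall fun y => ?_)
          simp only [Pi.sub_apply]; ring
        simp_rw [add_mul]
        rw [integral_add hi1 hi2, integral_const_mul, h0, mul_zero, zero_add,
          le_add_iff_nonneg_right]
        refine mul_nonneg (by positivity) (integral_nonneg_of_ae ?_)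
        filter_upwards [hpos] with y hy
        rcases le_total R ‖y‖ with hRy | hRy
        · exact mul_nonneg Real.posLog_nonneg (hy ((hR ‖y‖ hRy).1 y rfl))
        · rw [show Real.posLog (R⁻¹ * ‖(0 : Plane) - y‖) = 0 by
            rw [Real.posLog_eq_zero_iff, abs_of_nonneg (by positivity), zero_sub, norm_neg,
              inv_mul_le_iff₀ hR0, mul_one]
            exact hRy, zero_mul]
          rfl
      refine ⟨planeIso R, fun y => ?_⟩
      rw [eq_of_le_circMean hvc hex hge (z := planeIso R) (by simp)]
      exact hex y
  have hM : B < v x₁ := hx₂.trans_le (hx₁ x₂)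
  -- Near a maximum point `v > B`, hence `h ≥ 0` and small circle means are at least the centre
  -- value. So `v` is locally, then globally, constant, and `h ≥ 0` with mean zero must vanish.
  have hclopen : IsClopen {x | v x = v x₁} := by
    refine ⟨isClosed_eq hvc continuous_const, Metric.isOpen_iff.2 fun x hx => ?_⟩
    have hx' : v x = v x₁ := hx
    obtain ⟨δ, hδ, hball⟩ := Metric.eventually_nhds_iff_ball.1
      (hvc.continuousAt.eventually (lt_mem_nhds (hx'.symm ▸ hM : B < v x)))
    refine ⟨δ, hδ, fun z hz => ?_⟩
    rcases eq_or_ne z x with rfl | hzx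
    · exact hx
    have hr : 0 < ‖z - x‖ := norm_pos_iff.2 (sub_ne_zero.2 hzx)
    set r := ‖z - x‖
    have hrδ : r < δ := by simpa [dist_eq_norm] using hz
    refine eq_of_le_circMean hvc hx₁ (r := r) (x := x) ?_ (abs_of_pos hr).symm
    rw [← hx', hmean x r hr, (circMean_logPot hh' hs x hr).2, hv]
    simp only [logPot]
    refine add_le_add le_rfl (mul_le_mul_of_nonneg_left ?_ (by positivity))
    refine integral_mono_ae (hh'.integrable_log_mul hs x) (circMean_logPot hh' hs x hr).1 ?_
    have hne : ∀ᵐ y : Plane, y ≠ x := by simp [ae_iff]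
    filter_upwards [hpos, hne] with y hy hyx
    have hyx' : 0 < ‖x - y‖ := norm_pos_iff.2 (sub_ne_zero.2 hyx.symm)
    rcases le_total r ‖x - y‖ with hry | hry
    · rw [Real.posLog_eq_log (by
        rw [abs_of_nonneg (by positivity), le_inv_mul_iff₀ hr, mul_one]; exact hry),
        Real.log_mul (by positivity) hyx'.ne', Real.log_inv]
      simp
    · rw [(Real.posLog_eq_zero_iff _).2 (by
        rw [abs_of_nonneg (by positivity), inv_mul_le_iff₀ hr, mul_one]; exact hry), add_zero]
      refine mul_le_mul_of_nonneg_right (Real.log_le_log hyx' hry) (hy (hball y ?_))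
      rw [Metric.mem_ball, dist_comm, dist_eq_norm]
      exact lt_of_le_of_lt hry hrδ
  have huniv : {x | v x = v x₁} = Set.univ := hclopen.eq_univ ⟨x₁, rfl⟩
  have hnn : 0 ≤ᵐ[volume] h := by
    filter_upwards [hpos] with y hy
    refine hy ?_
    have : y ∈ {x | v x = v x₁} := huniv ▸ Set.mem_univ y
    exact hM.trans_eq this.symm
  exact (integral_eq_zero_iff_of_nonneg_ae hnn hint).1 h0

/-! ### Calculus of the Laplacian and Green's identity. -/

theorem ContDiff.fderiv_apply_const {E : Type*} [NormedAddCommGroup E]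
    [NormedSpace ℝ E] {f : E → ℝ} (hf : ContDiff ℝ ∞ f) (v : E) :
    ContDiff ℝ ∞ (fun z => fderiv ℝ f z v) :=
  (hf.fderiv_right (m := ∞) (by simp)).clm_apply contDiff_const

section Laplacian

variable {E : Type*} [NormedAddCommGroup E] [InnerProductSpace ℝ E] [FiniteDimensional ℝ E]

theorem laplacian_eq_sum_fderiv {ι : Type*} [Fintype ι] (b : OrthonormalBasis ι ℝ E) {f : E → ℝ}
    (hf : ContDiff ℝ 2 f) (x : E) :
    Laplacian.laplacian f x = ∑ i, fderiv ℝ (fun z => fderiv ℝ f z (b i)) x (b i) := by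
  rw [InnerProductSpace.laplacian_eq_iteratedFDeriv_orthonormalBasis f b]
  refine Finset.sum_congr rfl fun i _ => ?_
  have hd : DifferentiableAt ℝ (fderiv ℝ f) x :=
    (hf.fderiv_right (m := 1) (by norm_num)).differentiable one_ne_zero x
  rw [iteratedFDeriv_two_apply, fderiv_clm_apply hd (by fun_prop)]
  simp

theorem continuous_laplacian {f : E → ℝ} (hf : ContDiff ℝ ∞ f) :
    Continuous (Laplacian.laplacian f) := by
  have : Laplacian.laplacian f = fun x => ∑ i, fderiv ℝ
      (fun z => fderiv ℝ f z (stdOrthonormalBasis ℝ E i)) x (stdOrthonormalBasis ℝ E i) :=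
    funext (laplacian_eq_sum_fderiv _ (hf.of_le ENat.LEInfty.out))
  rw [this]
  exact continuous_finsetSum _ fun i _ =>
    ((hf.fderiv_apply_const _).fderiv_apply_const _).continuous

theorem HasCompactSupport.laplacian {f : E → ℝ} (hc : HasCompactSupport f) :
    HasCompactSupport (Laplacian.laplacian f) := by
  refine HasCompactSupport.intro' hc (isClosed_tsupport f) fun x hx => ?_
  have h0 : f =ᶠ[nhds x] fun _ => 0 := notMem_tsupport_iff_eventuallyEq.1 hx
  exact (InnerProductSpace.laplacian_congr_nhds h0).eq_of_nhds.trans (by simp)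

theorem laplacian_comp_add_right {f : E → ℝ} (hf : ContDiff ℝ ∞ f) (a x : E) :
    Laplacian.laplacian (fun z => f (z + a)) x = Laplacian.laplacian f (x + a) := by
  have h2 : (2 : WithTop ℕ∞) ≤ ∞ := ENat.LEInfty.out
  have hs : ContDiff ℝ ∞ (fun z => f (z + a)) := hf.comp (contDiff_id.add contDiff_const)
  rw [laplacian_eq_sum_fderiv (stdOrthonormalBasis ℝ E) (hs.of_le h2),
    laplacian_eq_sum_fderiv (stdOrthonormalBasis ℝ E) (hf.of_le h2)]
  refine Finset.sum_congr rfl fun i _ => ?_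
  simp_rw [fderiv_comp_add_right]
  rw [fderiv_comp_add_right (f := fun z => fderiv ℝ f z (stdOrthonormalBasis ℝ E i))]

variable [MeasurableSpace E] [BorelSpace E]

theorem integral_mul_fderiv_fderiv {f g : E → ℝ} (hf : ContDiff ℝ ∞ f) (hg : ContDiff ℝ ∞ g)
    (hc : HasCompactSupport g) (v : E) :
    ∫ x, f x * fderiv ℝ (fun z => fderiv ℝ g z v) x v =
      ∫ x, fderiv ℝ (fun z => fderiv ℝ f z v) x v * g x := by
  have hf' := hf.fderiv_apply_const v
  have hf'' := hf'.fderiv_apply_const v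
  have hg' := hg.fderiv_apply_const v
  have hg'' := hg'.fderiv_apply_const v
  have hc' : HasCompactSupport fun z => fderiv ℝ g z v := hc.fderiv_apply ℝ v
  have hc'' : HasCompactSupport fun x => fderiv ℝ (fun z => fderiv ℝ g z v) x v :=
    hc'.fderiv_apply ℝ v
  have int : ∀ {a b : E → ℝ}, ContDiff ℝ ∞ a → ContDiff ℝ ∞ b → HasCompactSupport b →
      Integrable (fun x => a x * b x) := fun ha hb hcb =>
    (ha.continuous.mul hb.continuous).integrable_of_hasCompactSupport hcb.mul_left
  have hd : ∀ {a : E → ℝ}, ContDiff ℝ ∞ a → ∀ x, DifferentiableAt ℝ a x := fun ha =>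
    ha.differentiable (by simp)
  rw [integral_mul_fderiv_eq_neg_fderiv_mul_of_integrable (f := f) (g := fun z => fderiv ℝ g z v)
      (int hf' hg' hc') (int hf hg'' hc'') (int hf hg' hc') (fun x _ => hd hf x)
      (fun x _ => hd hg' x),
    integral_mul_fderiv_eq_neg_fderiv_mul_of_integrable (f := fun z => fderiv ℝ f z v) (g := g)
      (int hf'' hg hc) (int hf' hg' hc') (int hf' hg hc) (fun x _ => hd hf' x)
      (fun x _ => hd hg x), neg_neg]

theorem integral_mul_laplacian {f g : E → ℝ} (hf : ContDiff ℝ ∞ f) (hg : ContDiff ℝ ∞ g)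
    (hc : HasCompactSupport g) :
    ∫ x, f x * Laplacian.laplacian g x = ∫ x, Laplacian.laplacian f x * g x := by
  set b := stdOrthonormalBasis ℝ E
  have h2 : (2 : WithTop ℕ∞) ≤ ∞ := ENat.LEInfty.out
  simp_rw [laplacian_eq_sum_fderiv b (hg.of_le h2), laplacian_eq_sum_fderiv b (hf.of_le h2),
    Finset.mul_sum, Finset.sum_mul]
  rw [integral_finsetSum, integral_finsetSum]
  · exact Finset.sum_congr rfl fun i _ => integral_mul_fderiv_fderiv hf hg hc (b i)
  · exact fun i _ => (((hf.fderiv_apply_const _).fderiv_apply_const _).continuous.mul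
      hg.continuous).integrable_of_hasCompactSupport hc.mul_left
  · exact fun i _ => (hf.continuous.mul ((hg.fderiv_apply_const _).fderiv_apply_const
      _).continuous).integrable_of_hasCompactSupport
        (((hc.fderiv_apply ℝ (b i)).fderiv_apply ℝ (b i)).mul_left)

end Laplacian

/-! ### The logarithm as fundamental solution. -/

/-- A smooth regularisation of `log ‖x‖`. -/
noncomputable def smoothLog (ε : ℝ) (x : Plane) : ℝ := 2⁻¹ * Real.log (‖x‖ ^ 2 + ε ^ 2)

theorem contDiff_smoothLog {ε : ℝ} (hε : 0 < ε) : ContDiff ℝ ∞ (smoothLog ε) := by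
  unfold smoothLog
  exact contDiff_const.mul (((contDiff_norm_sq ℝ).add contDiff_const).log
    fun x => by positivity)

/-- The result is `ε⁻²` times the profile `2/(1+|z|²)²` at `z = x/ε`: an approximate identity of
total mass `2π`. -/
theorem laplacian_smoothLog {ε : ℝ} (hε : 0 < ε) (x : Plane) :
    Laplacian.laplacian (smoothLog ε) x = 2 * ε ^ 2 / (‖x‖ ^ 2 + ε ^ 2) ^ 2 := by
  have hA : ∀ z : Plane, ‖z‖ ^ 2 + ε ^ 2 ≠ 0 := fun z => by positivity
  have hsq : ∀ z : Plane, HasFDerivAt (fun z : Plane => ‖z‖ ^ 2 + ε ^ 2) (2 • innerSL ℝ z) z :=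
    fun z => (hasStrictFDerivAt_norm_sq z).hasFDerivAt.add_const _
  have h1 : ∀ z w : Plane, fderiv ℝ (smoothLog ε) z w = inner ℝ z w * (‖z‖ ^ 2 + ε ^ 2)⁻¹ := by
    intro z w
    have := ((hsq z).log (hA z)).const_mul 2⁻¹
    have e : fderiv ℝ (smoothLog ε) z = _ := this.fderiv
    rw [e]
    simp
    ring
  have h2 : ∀ w : Plane, fderiv ℝ (fun z => fderiv ℝ (smoothLog ε) z w) x w =
      ‖w‖ ^ 2 * (‖x‖ ^ 2 + ε ^ 2)⁻¹ - 2 * (inner ℝ x w) ^ 2 * ((‖x‖ ^ 2 + ε ^ 2) ^ 2)⁻¹ := by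
    intro w
    simp_rw [h1]
    have hi : HasFDerivAt (fun z : Plane => inner ℝ z w) (innerSL ℝ w) x := by
      simp_rw [real_inner_comm]
      exact (innerSL ℝ w).hasFDerivAt
    have hinv := (hasDerivAt_inv (hA x)).comp_hasFDerivAt x (hsq x)
    have := hi.mul hinv
    have e : fderiv ℝ (fun z : Plane => inner ℝ z w * (‖z‖ ^ 2 + ε ^ 2)⁻¹) x = _ := this.fderiv
    rw [e]
    simp
    ring
  set b := EuclideanSpace.basisFun (Fin 2) ℝ
  rw [laplacian_eq_sum_fderiv b ((contDiff_smoothLog hε).of_le ENat.LEInfty.out)]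
  simp_rw [h2]
  rw [Finset.sum_sub_distrib, ← Finset.sum_mul, ← Finset.sum_mul, ← Finset.mul_sum,
    b.sum_sq_inner_left]
  simp only [b.norm_eq_one, one_pow, Finset.sum_const, Finset.card_univ, Fintype.card_fin]
  have := hA x
  field_simp
  ring

theorem integrable_and_integral_inv_one_add_sq_sq :
    Integrable (fun z : Plane => 2 / (1 + ‖z‖ ^ 2) ^ 2) ∧
      ∫ z : Plane, 2 / (1 + ‖z‖ ^ 2) ^ 2 = 2 * Real.pi := by
  have hd : ∀ y ∈ Set.Ici (0:ℝ), HasDerivAt (fun y : ℝ => -(1 + y ^ 2)⁻¹)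
      (y * (2 / (1 + y ^ 2) ^ 2)) y := by
    intro y _
    have h0 : (1 + y ^ 2) ≠ 0 := by positivity
    have := (((hasDerivAt_pow 2 y).const_add 1).inv h0).neg
    refine this.congr_deriv ?_
    simp
    field_simp
  have hnn : ∀ y ∈ Set.Ioi (0:ℝ), 0 ≤ y * (2 / (1 + y ^ 2) ^ 2) := fun y hy => by
    have : (0:ℝ) < y := hy
    positivity
  have hl : Tendsto (fun y : ℝ => -(1 + y ^ 2)⁻¹) atTop (nhds 0) := by
    have : Tendsto (fun y : ℝ => 1 + y ^ 2) atTop atTop :=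
      tendsto_atTop_add_const_left _ _ (tendsto_pow_atTop two_ne_zero)
    simpa using this.inv_tendsto_atTop.neg
  have hi := integrableOn_Ioi_deriv_of_nonneg' hd hnn hl
  have hv := integral_Ioi_of_hasDerivAt_of_nonneg' hd hnn hl
  constructor
  · rw [integrable_fun_norm_addHaar (μ := (volume : Measure Plane))
      (f := fun r : ℝ => 2 / (1 + r ^ 2) ^ 2)]
    simpa using hi
  · rw [integral_fun_norm_addHaar (volume : Measure Plane) (fun r : ℝ => 2 / (1 + r ^ 2) ^ 2)]
    have : (volume : Measure Plane).real (Metric.ball 0 1) = Real.pi := by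
      rw [Measure.real, EuclideanSpace.volume_ball_fin_two]
      simp [Real.pi_pos.le]
    rw [this]
    simp only [finrank_euclideanSpace, Fintype.card_fin, Nat.add_one_sub_one, pow_one, smul_eq_mul,
      hv]
    simp

theorem integral_smoothLog_mul_laplacian {φ : Plane → ℝ} (hφ : ContDiff ℝ ∞ φ)
    (hc : HasCompactSupport φ) {ε : ℝ} (hε : 0 < ε) :
    ∫ x, smoothLog ε x * Laplacian.laplacian φ x =
      ∫ z : Plane, 2 / (1 + ‖z‖ ^ 2) ^ 2 * φ (ε • z) := by
  rw [integral_mul_laplacian (contDiff_smoothLog hε) hφ hc]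
  simp_rw [laplacian_smoothLog hε]
  have h := Measure.integral_comp_smul (volume : Measure Plane)
    (fun x => 2 * ε ^ 2 / (‖x‖ ^ 2 + ε ^ 2) ^ 2 * φ x) ε
  rw [finrank_euclideanSpace, Fintype.card_fin, abs_of_pos (by positivity), smul_eq_mul,
    eq_inv_mul_iff_mul_eq₀ (by positivity), ← integral_const_mul] at h
  rw [← h]
  congr 1
  ext z
  rw [norm_smul, Real.norm_of_nonneg hε.le]
  have : 1 + ‖z‖ ^ 2 ≠ 0 := by positivity
  have : (ε * ‖z‖) ^ 2 + ε ^ 2 ≠ 0 := by positivity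
  field_simp
  ring

theorem exists_potAdmissible_of_hasCompactSupport {g : Plane → ℝ} (hg : Continuous g)
    (hc : HasCompactSupport g) : ∃ s, 0 < s ∧ s ≤ 1 ∧ PotAdmissible s s g := by
  have hi1 : Integrable (fun x => |g x| * (1 + ‖x‖) ^ (2:ℝ)) :=
    Continuous.integrable_of_hasCompactSupport (by fun_prop (disch := intros; simp))
      hc.norm.mul_right
  have hi2 : Integrable (fun x => |g x| ^ (2:ℝ) * (1 + ‖x‖) ^ (0:ℝ)) := by
    simp only [Real.rpow_zero, mul_one, Real.rpow_two]
    exact Continuous.integrable_of_hasCompactSupport (by fun_prop)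
      (hc.comp_left (g := fun t : ℝ => |t| ^ 2) (by simp))
  obtain ⟨s₀, hs₀, h⟩ := exists_potAdmissible (κ := 0) (τ := 1) hg.measurable.aemeasurable
    one_lt_two hi1 hi2 (by norm_num)
  have hs : 0 < min s₀ 1 := by positivity
  refine ⟨min s₀ 1, hs, min_le_right _ _, ?_⟩
  exact ((h _ hs.le (min_le_left _ _)).mono (min_le_right _ _) hs.le le_rfl).of_abs_le
    hg.aestronglyMeasurable 1 (Eventually.of_forall fun y => by simp)

/-- The integral of `smoothLog ε` against the Laplacian of `φ` is passed to the limit `ε → 0` twice: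
directly, and after Green's identity and rescaling, where it concentrates at the origin. -/
theorem integral_log_norm_mul_laplacian {φ : Plane → ℝ} (hφ : ContDiff ℝ ∞ φ)
    (hc : HasCompactSupport φ) :
    ∫ x, Real.log ‖x‖ * Laplacian.laplacian φ x = 2 * Real.pi * φ 0 := by
  have hg := continuous_laplacian hφ
  have hgc := hc.laplacian
  obtain ⟨s, hs, hs1, hadm⟩ := exists_potAdmissible_of_hasCompactSupport hg hgc
  have hlog : Integrable (fun x => Real.log ‖x‖ * Laplacian.laplacian φ x) := by
    simpa using hadm.integrable_log_mul hs 0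
  have hε : ∀ n : ℕ, 0 < 1 / ((n : ℝ) + 1) := fun n => by positivity
  have hε0 := tendsto_one_div_add_atTop_nhds_zero_nat (𝕜 := ℝ)
  have hl1 : Tendsto (fun n : ℕ => ∫ x, smoothLog (1 / ((n : ℝ) + 1)) x * Laplacian.laplacian φ x)
      atTop (nhds (∫ x, Real.log ‖x‖ * Laplacian.laplacian φ x)) := by
    refine tendsto_integral_of_dominated_convergence
      (fun x => |Real.log ‖x‖ * Laplacian.laplacian φ x| +
        |smoothLog 1 x * Laplacian.laplacian φ x|) (fun n => ?_) (hlog.abs.add ?_) (fun n => ?_) ?_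
    · exact ((contDiff_smoothLog (hε n)).continuous.mul hg).aestronglyMeasurable
    · exact (((contDiff_smoothLog one_pos).continuous.mul hg).integrable_of_hasCompactSupport
        hgc.mul_left).abs
    · have hne : ∀ᵐ x : Plane, x ≠ 0 := by simp [ae_iff]
      filter_upwards [hne] with x hx
      have hx' := norm_pos_iff.2 hx
      have hε1 : 1 / ((n : ℝ) + 1) ≤ 1 := by
        rw [div_le_one (by positivity)]; linarith [Nat.cast_nonneg (α := ℝ) n]
      -- The regularisation lies between `log |x|` and `smoothLog 1`, which supplies the dominating
      -- function.
      have a1 : Real.log ‖x‖ ≤ smoothLog (1 / ((n : ℝ) + 1)) x := by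
        have := Real.log_le_log (by positivity)
          (show ‖x‖ ^ 2 ≤ ‖x‖ ^ 2 + (1 / ((n : ℝ) + 1)) ^ 2 by linarith [sq_nonneg (1 / ((n : ℝ) + 1))])
        rw [Real.log_pow] at this
        push_cast at this
        rw [smoothLog]; linarith
      have a2 : smoothLog (1 / ((n : ℝ) + 1)) x ≤ smoothLog 1 x := by
        unfold smoothLog
        gcongr
      rw [norm_mul, Real.norm_eq_abs, Real.norm_eq_abs, abs_mul, abs_mul, ← add_mul]
      refine mul_le_mul_of_nonneg_right ?_ (abs_nonneg _)
      rw [abs_le]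
      constructor
      · linarith [neg_abs_le (Real.log ‖x‖), abs_nonneg (smoothLog 1 x)]
      · linarith [le_abs_self (smoothLog 1 x), abs_nonneg (Real.log ‖x‖)]
    · have hne : ∀ᵐ x : Plane, x ≠ 0 := by simp [ae_iff]
      filter_upwards [hne] with x hx
      have hx' := norm_pos_iff.2 hx
      refine Tendsto.mul_const _ ?_
      have : Tendsto (fun t : ℝ => 2⁻¹ * Real.log (‖x‖ ^ 2 + t ^ 2)) (nhds 0)
          (nhds (2⁻¹ * Real.log (‖x‖ ^ 2 + 0 ^ 2))) := by
        refine Tendsto.const_mul _ (Tendsto.log ?_ (by positivity))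
        exact Continuous.tendsto (by fun_prop) 0
      have e : 2⁻¹ * Real.log (‖x‖ ^ 2 + 0 ^ 2) = Real.log ‖x‖ := by
        rw [zero_pow two_ne_zero, add_zero, Real.log_pow]; push_cast; ring
      rw [e] at this
      exact this.comp hε0
  have hl2 : Tendsto (fun n : ℕ => ∫ x, smoothLog (1 / ((n : ℝ) + 1)) x * Laplacian.laplacian φ x)
      atTop (nhds (2 * Real.pi * φ 0)) := by
    simp_rw [fun n : ℕ => integral_smoothLog_mul_laplacian hφ hc (hε n)]
    rw [← integrable_and_integral_inv_one_add_sq_sq.2, ← integral_mul_const]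
    obtain ⟨M, hM⟩ := hc.exists_bound_of_continuous hφ.continuous
    have hcz : Continuous fun z : Plane => 2 / (1 + ‖z‖ ^ 2) ^ 2 := by
      fun_prop (disch := intros; positivity)
    refine tendsto_integral_of_dominated_convergence (fun z => 2 / (1 + ‖z‖ ^ 2) ^ 2 * M)
      (fun n => ?_) (integrable_and_integral_inv_one_add_sq_sq.1.mul_const M) (fun n => ?_) ?_
    · exact (hcz.mul (hφ.continuous.comp (continuous_const_smul _))).aestronglyMeasurable
    · refine Eventually.of_forall fun z => ?_
      rw [norm_mul, Real.norm_of_nonneg (by positivity)]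
      exact mul_le_mul_of_nonneg_left (hM _) (by positivity)
    · refine Eventually.of_forall fun z => Tendsto.const_mul _ ?_
      have : Tendsto (fun t : ℝ => φ (t • z)) (nhds 0) (nhds (φ ((0:ℝ) • z))) :=
        (hφ.continuous.comp (continuous_id.smul continuous_const)).tendsto 0
      rw [zero_smul] at this
      exact this.comp hε0
  exact tendsto_nhds_unique hl1 hl2

theorem integral_log_norm_sub_mul_laplacian {φ : Plane → ℝ} (hφ : ContDiff ℝ ∞ φ)
    (hc : HasCompactSupport φ) (y : Plane) :
    ∫ x, Real.log ‖x - y‖ * Laplacian.laplacian φ x = 2 * Real.pi * φ y := by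
  have hφ' : ContDiff ℝ ∞ (fun z => φ (z + y)) := hφ.comp (contDiff_id.add contDiff_const)
  have hc' : HasCompactSupport (fun z => φ (z + y)) :=
    hc.comp_homeomorph (Homeomorph.addRight y)
  have := integral_log_norm_mul_laplacian hφ' hc'
  simp_rw [laplacian_comp_add_right hφ y, zero_add] at this
  rw [← this, ← integral_sub_right_eq_self (fun x => Real.log ‖x‖ * Laplacian.laplacian φ (x + y)) y]
  simp

/-- The logarithmic potential of `h` solves `Δ u = h` in the sense of distributions. -/
theorem integral_logPot_mul_laplacian {s : ℝ} {h : Plane → ℝ} (hh : PotAdmissible s s h)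
    (hs : 0 < s) {φ : Plane → ℝ} (hφ : ContDiff ℝ ∞ φ) (hc : HasCompactSupport φ) :
    ∫ x, logPot h x * Laplacian.laplacian φ x = ∫ y, h y * φ y := by
  obtain ⟨C, hC0, hC⟩ := hh.integral_abs_log_mul_le hs
  have hg := continuous_laplacian hφ
  have hgc := hc.laplacian
  set g := Laplacian.laplacian φ
  set G : Plane → Plane → ℝ := fun x y => Real.log ‖x - y‖ * h y * g x with hG
  have hm : AEStronglyMeasurable (Function.uncurry G) ((volume : Measure Plane).prod volume) := by
    refine AEStronglyMeasurable.mul (AEStronglyMeasurable.mul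
      (Measurable.aestronglyMeasurable ?_) hh.1.comp_snd) hg.aestronglyMeasurable.comp_fst
    fun_prop
  have hint : Integrable (Function.uncurry G) ((volume : Measure Plane).prod volume) := by
    rw [integrable_prod_iff hm]
    refine ⟨Eventually.of_forall fun x => (hh.integrable_log_mul hs x).mul_const (g x), ?_⟩
    have hm' : AEStronglyMeasurable (fun x => ∫ y, ‖Function.uncurry G (x, y)‖) volume :=
      hm.norm.integral_prod_right'
    have hb : Integrable (fun x => C * (1 + ‖x‖) ^ s * |g x|) := by
      refine Continuous.integrable_of_hasCompactSupport ?_ hgc.norm.mul_left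
      fun_prop (disch := intros; positivity)
    refine hb.mono' hm' (Eventually.of_forall fun x => ?_)
    rw [Real.norm_of_nonneg (integral_nonneg fun _ => norm_nonneg _)]
    simp only [Function.uncurry, hG, norm_mul _ (g x), integral_mul_const, Real.norm_eq_abs]
    exact mul_le_mul_of_nonneg_right (hC x) (abs_nonneg _)
  -- Fubini transfers the Laplacian to the kernel centred at `y`, where the fundamental solution
  -- returns `2π φ(y)`.
  have h1 := integral_integral_swap hint
  simp only [hG] at h1
  have e1 : ∀ x, logPot h x * g x = (2 * Real.pi)⁻¹ * ∫ y, Real.log ‖x - y‖ * h y * g x := by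
    intro x
    rw [integral_mul_const, logPot]; ring
  have e2 : ∀ y, ∫ x, Real.log ‖x - y‖ * h y * g x = 2 * Real.pi * (h y * φ y) := by
    intro y
    have := integral_log_norm_sub_mul_laplacian hφ hc y
    calc _ = ∫ x, h y * (Real.log ‖x - y‖ * g x) := by congr 1; ext x; ring
      _ = _ := by rw [integral_const_mul, this]; ring
  simp_rw [e1]
  rw [integral_const_mul, h1]
  simp_rw [e2]
  rw [integral_const_mul, inv_mul_cancel_left₀ Real.two_pi_pos.ne']

/-! ### Liouville theorem for weakly harmonic functions. -/

theorem laplacian_comp_linearIsometryEquiv {E F : Type*} [NormedAddCommGroup E]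
    [InnerProductSpace ℝ E] [FiniteDimensional ℝ E] [NormedAddCommGroup F] [InnerProductSpace ℝ F]
    [FiniteDimensional ℝ F] (e : E ≃ₗᵢ[ℝ] F) {f : F → ℝ} (hf : ContDiff ℝ ∞ f) (x : E) :
    Laplacian.laplacian (fun z => f (e z)) x = Laplacian.laplacian f (e x) := by
  set b := stdOrthonormalBasis ℝ E
  have hs : ContDiff ℝ ∞ (fun z => f (e z)) := hf.comp e.contDiff
  have hd : ∀ {g : F → ℝ}, ContDiff ℝ ∞ g → ∀ z v, fderiv ℝ (fun z => g (e z)) z v =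
      fderiv ℝ g (e z) (e v) := fun {g} hg z v => by
    have h1 := ((hg.differentiable (by simp)) (e z)).hasFDerivAt.comp z
      (e : E ≃L[ℝ] F).hasFDerivAt
    have h2 : fderiv ℝ (fun z => g (e z)) z = _ := h1.fderiv
    rw [h2]; rfl
  rw [laplacian_eq_sum_fderiv b (hs.of_le ENat.LEInfty.out),
    laplacian_eq_sum_fderiv (b.map e) (hf.of_le ENat.LEInfty.out)]
  refine Finset.sum_congr rfl fun i _ => ?_
  simp_rw [hd hf]
  rw [hd (hf.fderiv_apply_const (e (b i)))]
  simp

theorem laplacian_comp_const_sub {E : Type*} [NormedAddCommGroup E] [InnerProductSpace ℝ E]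
    [FiniteDimensional ℝ E] {f : E → ℝ} (hf : ContDiff ℝ ∞ f) (a x : E) :
    Laplacian.laplacian (fun z => f (a - z)) x = Laplacian.laplacian f (a - x) := by
  have hs : ContDiff ℝ ∞ (fun z => f (z + a)) := hf.comp (contDiff_id.add contDiff_const)
  have h := laplacian_comp_linearIsometryEquiv (LinearIsometryEquiv.neg ℝ) hs x
  rw [laplacian_comp_add_right hf] at h
  simpa [neg_add_eq_sub] using h

theorem contDiff_convolution_and_laplacian {E : Type*} [NormedAddCommGroup E]
    [InnerProductSpace ℝ E] [FiniteDimensional ℝ E] [MeasurableSpace E] [BorelSpace E]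
    {w g : E → ℝ} (hw : Continuous w) (hg : ContDiff ℝ ∞ g) (hc : HasCompactSupport g) :
    ContDiff ℝ ∞ (fun x => ∫ t, w t * g (x - t)) ∧
    ∀ x, Laplacian.laplacian (fun x => ∫ t, w t * g (x - t)) x =
      ∫ t, w t * Laplacian.laplacian g (x - t) := by
  have hl : LocallyIntegrable w (volume : Measure E) := hw.locallyIntegrable
  have hsm : ∀ {g : E → ℝ}, ContDiff ℝ ∞ g → HasCompactSupport g →
      ContDiff ℝ ∞ (fun x => ∫ t, w t * g (x - t)) := fun hg hc =>
    hc.contDiff_convolution_right (ContinuousLinearMap.mul ℝ ℝ) (n := (⊤ : ℕ∞)) hl hg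
  have hder : ∀ {g : E → ℝ}, ContDiff ℝ ∞ g → HasCompactSupport g → ∀ x v,
      fderiv ℝ (fun x => ∫ t, w t * g (x - t)) x v = ∫ t, w t * fderiv ℝ g (x - t) v := by
    intro g hg hc x v
    have hg1 : ContDiff ℝ 1 g := hg.of_le (by exact_mod_cast le_top)
    have h := hc.hasFDerivAt_convolution_right (ContinuousLinearMap.mul ℝ ℝ) hl hg1 x
    have h2 : fderiv ℝ (fun x => ∫ t, w t * g (x - t)) x = _ := h.fderiv
    rw [h2, convolution_precompR_apply _ hl (hc.fderiv ℝ) (hg1.continuous_fderiv one_ne_zero)]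
    rfl
  refine ⟨hsm hg hc, fun x => ?_⟩
  set b := stdOrthonormalBasis ℝ E
  rw [laplacian_eq_sum_fderiv b ((hsm hg hc).of_le ENat.LEInfty.out)]
  simp_rw [laplacian_eq_sum_fderiv b (hg.of_le ENat.LEInfty.out), Finset.mul_sum, hder hg hc]
  rw [integral_finsetSum]
  · refine Finset.sum_congr rfl fun i _ => ?_
    rw [hder (hg.fderiv_apply_const _) (hc.fderiv_apply ℝ _)]
  · intro i _
    have hc' := (hc.fderiv_apply ℝ (b i)).fderiv_apply ℝ (b i)
    refine (hw.mul (((hg.fderiv_apply_const (b i)).fderiv_apply_const (b i)).continuous.comp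
      (continuous_const.sub continuous_id))).integrable_of_hasCompactSupport
        (HasCompactSupport.mul_left ?_)
    exact hc'.comp_homeomorph (Homeomorph.subLeft x)

/-- A Liouville theorem: an entire function whose real part grows at most logarithmically is
constant. -/
theorem entire_eq_of_re_le_log {F : ℂ → ℂ} (hF : Differentiable ℂ F) {C : ℝ} (hC : 0 < C)
    (h : ∀ z, (F z).re ≤ C * (1 + Real.log (1 + ‖z‖))) (z w : ℂ) : F z = F w := by
  refine is_const_of_deriv_eq_zero hF (fun c => ?_) z w
  -- Borel–Carathéodory on the disc of radius `R`, then Cauchy's estimate on the circle of radius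
  -- `R/4` about `c`, which stays in the disc of radius `R/2`. The bound is `O(log R / R)`.
  have hbound : ∀ R : ℝ, 0 < R → 4 * ‖c‖ ≤ R →
      ‖deriv F c‖ ≤ (2 * (C * (1 + Real.log (1 + R))) + 3 * ‖F 0‖) / (R / 4) := by
    intro R hR hcR
    set M := C * (1 + Real.log (1 + R)) with hM
    have hM0 : 0 < M := by
      have := Real.log_nonneg (show 1 ≤ 1 + R by linarith)
      positivity
    refine Complex.norm_deriv_le_of_forall_mem_sphere_norm_le (by positivity)
      hF.diffContOnCl fun ζ hζ => ?_
    have hζ' : ‖ζ‖ ≤ R / 2 := by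
      rw [mem_sphere_iff_norm] at hζ
      have := norm_add_le (ζ - c) c
      rw [sub_add_cancel] at this
      linarith
    have hmaps : Set.MapsTo F (Metric.ball 0 R) {z | z.re ≤ M} := fun ξ hξ => by
      refine (h ξ).trans ?_
      rw [mem_ball_zero_iff] at hξ
      rw [hM]; gcongr
    refine (Complex.borelCaratheodory hM0 hF.differentiableOn hmaps hR
      (by rw [mem_ball_zero_iff]; linarith)).trans ?_
    have hRz : 0 < R - ‖ζ‖ := by linarith
    have h1 : 2 * M * ‖ζ‖ / (R - ‖ζ‖) ≤ 2 * M := by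
      rw [div_le_iff₀ hRz]; gcongr; linarith
    have h2 : ‖F 0‖ * (R + ‖ζ‖) / (R - ‖ζ‖) ≤ 3 * ‖F 0‖ := by
      rw [div_le_iff₀ hRz]
      nlinarith [norm_nonneg (F 0)]
    linarith
  have hlim : Tendsto (fun R : ℝ => (2 * (C * (1 + Real.log (1 + R))) + 3 * ‖F 0‖) / (R / 4))
      atTop (nhds 0) := by
    have h1 : Tendsto (fun R : ℝ => Real.log (1 + R) / (1 + R)) atTop (nhds 0) := by
      have := (Real.isLittleO_log_id_atTop.tendsto_div_nhds_zero).comp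
        (tendsto_atTop_add_const_left atTop (1:ℝ) tendsto_id)
      exact this
    have h2 : Tendsto (fun R : ℝ => R⁻¹) atTop (nhds 0) := tendsto_inv_atTop_zero
    have h3 : Tendsto (fun R : ℝ => 8 * C * (Real.log (1 + R) / (1 + R)) * (1 + R⁻¹) +
        (8 * C + 12 * ‖F 0‖) * R⁻¹) atTop
        (nhds (8 * C * 0 * (1 + 0) + (8 * C + 12 * ‖F 0‖) * 0)) :=
      ((h1.const_mul _).mul (h2.const_add 1)).add (h2.const_mul _)
    rw [show (8 * C * 0 * (1 + 0) + (8 * C + 12 * ‖F 0‖) * 0) = 0 by ring] at h3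
    refine h3.congr' ?_
    filter_upwards [eventually_gt_atTop 0] with R hR
    field_simp
    ring
  have : ‖deriv F c‖ ≤ 0 := by
    refine ge_of_tendsto hlim ?_
    filter_upwards [eventually_gt_atTop 0, eventually_ge_atTop (4 * ‖c‖)] with R h1 h2
    exact hbound R h1 h2
  exact norm_le_zero_iff.1 this

/-- A continuous function which is harmonic in the sense of distributions and grows at most
logarithmically is constant. -/
theorem eq_of_weakly_harmonic {w : Plane → ℝ} (hw : Continuous w)
    (hweak : ∀ φ : Plane → ℝ, ContDiff ℝ ∞ φ → HasCompactSupport φ →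
      ∫ x, w x * Laplacian.laplacian φ x = 0)
    {C : ℝ} (hC : 0 < C) (hle : ∀ x, w x ≤ C * (1 + Real.log (1 + ‖x‖))) (x y : Plane) :
    w x = w y := by
  set ψ : ℕ → ContDiffBump (0 : Plane) := fun n =>
    ⟨1 / (2 * ((n : ℝ) + 1)), 1 / ((n : ℝ) + 1), by positivity, by
      apply one_div_lt_one_div_of_lt <;> [positivity; skip]
      linarith [Nat.cast_nonneg (α := ℝ) n]⟩ with hψ
  set η : ℕ → Plane → ℝ := fun n => (ψ n).normed volume with hη
  have hηs : ∀ n, ContDiff ℝ ∞ (η n) := fun n => (ψ n).contDiff_normed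
  have hηc : ∀ n, HasCompactSupport (η n) := fun n => (ψ n).hasCompactSupport_normed
  -- Mollification makes `w` smooth and classically harmonic, hence the real part of an entire
  -- function. Radii at most `1` preserve logarithmic growth, at the price of doubling `C`.
  set W : ℕ → Plane → ℝ := fun n x => ∫ t, w t * η n (x - t) with hW
  have hW' : ∀ n x, W n x = ∫ t, η n t * w (x - t) := fun n x => by
    rw [hW]
    simp only
    rw [← integral_sub_left_eq_self _ volume x]
    congr 1; ext t
    rw [sub_sub_cancel, mul_comm]
  have hconst : ∀ n x y, W n x = W n y := by
    intro n x y
    obtain ⟨hWs, hWl⟩ := contDiff_convolution_and_laplacian hw (hηs n) (hηc n)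
    have hΔ : ∀ x, Laplacian.laplacian (W n) x = 0 := by
      intro x
      have hs : ContDiff ℝ ∞ (fun z => η n (x - z)) := (hηs n).comp (contDiff_const.sub contDiff_id)
      have hc : HasCompactSupport (fun z => η n (x - z)) :=
        (hηc n).comp_homeomorph (Homeomorph.subLeft x)
      have := hweak _ hs hc
      simp_rw [laplacian_comp_const_sub (hηs n)] at this
      rw [hW, hWl x, this]
    have hharm : InnerProductSpace.HarmonicOnNhd (fun z => W n (planeIso z)) Set.univ := by
      intro z _
      refine ⟨((hWs.comp planeIso.contDiff).of_le ENat.LEInfty.out).contDiffAt,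
        Eventually.of_forall fun ζ => ?_⟩
      rw [laplacian_comp_linearIsometryEquiv planeIso hWs]
      exact hΔ _
    obtain ⟨F, hF, hFre⟩ := hharm.exists_analyticOnNhd_univ_re_eq
    have hFd : Differentiable ℂ F := fun z => (hF z trivial).differentiableAt
    have hbd : ∀ z, (F z).re ≤ 2 * C * (1 + Real.log (1 + ‖z‖)) := by
      intro z
      have e : (F z).re = W n (planeIso z) := congrFun hFre z
      rw [e, hW']
      set x := planeIso z with hx
      have hzx : ‖z‖ = ‖x‖ := (planeIso.norm_map z).symm
      have hint : Integrable (fun t => η n t * w (x - t)) :=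
        Continuous.integrable_of_hasCompactSupport
          ((hηs n).continuous.mul (hw.comp (continuous_const.sub continuous_id)))
          (hηc n).mul_right
      calc ∫ t, η n t * w (x - t) ≤ ∫ t, η n t * (2 * C * (1 + Real.log (1 + ‖z‖))) := by
            refine integral_mono hint ((ψ n).integrable_normed.mul_const _) fun t => ?_
            by_cases ht : η n t = 0
            · simp [ht]
            refine mul_le_mul_of_nonneg_left ?_ ((ψ n).nonneg_normed t)
            have ht1 : ‖t‖ ≤ 1 := by
              have : t ∈ Function.support (η n) := ht
              rw [hη, (ψ n).support_normed_eq, mem_ball_zero_iff] at this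
              have h1 : (ψ n).rOut ≤ 1 := by
                show 1 / ((n : ℝ) + 1) ≤ 1
                rw [div_le_one (by positivity)]; linarith [Nat.cast_nonneg (α := ℝ) n]
              linarith
            have h2 : Real.log (1 + ‖x - t‖) ≤ 1 + Real.log (1 + ‖z‖) := by
              have h3 : 1 + ‖x - t‖ ≤ 2 * (1 + ‖z‖) := by
                have := norm_sub_le x t
                rw [hzx]; linarith [norm_nonneg x]
              have h4 := Real.log_le_log (by positivity) h3
              rw [Real.log_mul (by norm_num) (by positivity)] at h4
              have : Real.log 2 ≤ 1 := by linarith [Real.log_two_lt_d9]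
              linarith
            have h5 := Real.log_nonneg (show 1 ≤ 1 + ‖z‖ by linarith [norm_nonneg z])
            refine (hle _).trans ?_
            nlinarith
        _ = 2 * C * (1 + Real.log (1 + ‖z‖)) := by
            rw [integral_mul_const, (ψ n).integral_normed, one_mul]
    have hFc := entire_eq_of_re_le_log hFd (by positivity) hbd (planeIso.symm x) (planeIso.symm y)
    have h1 := congrFun hFre (planeIso.symm x)
    have h2 := congrFun hFre (planeIso.symm y)
    simp only [planeIso.apply_symm_apply] at h1 h2
    rw [← h1, ← h2, hFc]
  have hlim : ∀ x, Tendsto (fun n => W n x) atTop (nhds (w x)) := by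
    intro x
    have := ContDiffBump.convolution_tendsto_right_of_continuous (μ := (volume : Measure Plane))
      (φ := ψ) (l := atTop) tendsto_one_div_add_atTop_nhds_zero_nat hw x
    refine this.congr fun n => ?_
    rw [hW' n x]; rfl
  exact tendsto_nhds_unique (hlim x) ((hlim y).congr fun n => hconst n y x)

/-! ### Negative definiteness of the logarithmic kernel. -/

/-- A non-integrable function has integral `0` by convention, while the Gaussian integral is
positive. -/
theorem integrable_exp_neg_mul_sq_norm {b : ℝ} (hb : 0 < b) :
    Integrable (fun z : Plane => Real.exp (-b * ‖z‖ ^ 2)) := by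
  by_contra h
  have h1 := GaussianFourier.integral_rexp_neg_mul_sq_norm (V := Plane) hb
  rw [integral_undef h] at h1
  have : 0 < (Real.pi / b) ^ (Module.finrank ℝ Plane / 2 : ℝ) := by positivity
  linarith

/-- The parallelogram law at the midpoint. Integrating in `z` exhibits the Gaussian kernel as a
positive multiple of a convolution square. -/
theorem exp_neg_mul_exp_neg_eq (t : ℝ) (x y z : Plane) :
    Real.exp (-(2 * t) * ‖x - z‖ ^ 2) * Real.exp (-(2 * t) * ‖y - z‖ ^ 2) =
      Real.exp (-t * ‖x - y‖ ^ 2) * Real.exp (-(4 * t) * ‖(2:ℝ)⁻¹ • (x + y) - z‖ ^ 2) := by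
  rw [← Real.exp_add, ← Real.exp_add]
  congr 1
  have h := parallelogram_law_with_norm ℝ (x - z) (y - z)
  rw [sub_sub_sub_cancel_right] at h
  have e : (x - z) + (y - z) = (2:ℝ) • ((2:ℝ)⁻¹ • (x + y) - z) := by
    rw [smul_sub, smul_smul, two_smul]; simp; abel
  rw [e, norm_smul] at h
  rw [Real.norm_of_nonneg (by norm_num : (0:ℝ) ≤ 2)] at h
  linear_combination (t) * h

/-- Positive definiteness of the Gaussian kernel. -/
theorem integral_gaussian_mul_nonneg {t : ℝ} (ht : 0 < t) {g : Plane → ℝ} (hg : Integrable g) :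
    0 ≤ ∫ p : Plane × Plane, Real.exp (-t * ‖p.1 - p.2‖ ^ 2) * (g p.1 * g p.2) := by
  set k : Plane → Plane → ℝ := fun x z => Real.exp (-(2 * t) * ‖x - z‖ ^ 2) with hk
  set c := ∫ z : Plane, Real.exp (-(4 * t) * ‖z‖ ^ 2) with hc
  have hc0 : 0 < c := integral_exp_pos (integrable_exp_neg_mul_sq_norm (by positivity))
  have hki : ∀ x y, Integrable (fun z => k x z * k y z) := fun x y => by
    simp_rw [hk, exp_neg_mul_exp_neg_eq]
    exact ((integrable_exp_neg_mul_sq_norm (by positivity : 0 < 4 * t)).comp_sub_left _).const_mul _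
  have hkk : ∀ x y, ∫ z, k x z * k y z = c * Real.exp (-t * ‖x - y‖ ^ 2) := fun x y => by
    simp_rw [hk, exp_neg_mul_exp_neg_eq]
    rw [integral_const_mul, hc, ← integral_sub_left_eq_self
      (fun z : Plane => Real.exp (-(4 * t) * ‖z‖ ^ 2)) volume ((2:ℝ)⁻¹ • (x + y)), mul_comm]
  have hgg : Integrable (fun p : Plane × Plane => g p.1 * g p.2) := hg.mul_prod hg
  set G : Plane × Plane → Plane → ℝ := fun p z => k p.1 z * k p.2 z * (g p.1 * g p.2) with hG
  have hm : AEStronglyMeasurable (Function.uncurry G)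
      ((volume : Measure (Plane × Plane)).prod (volume : Measure Plane)) := by
    refine AEStronglyMeasurable.mul (Continuous.aestronglyMeasurable ?_)
      hgg.aestronglyMeasurable.comp_fst
    fun_prop
  have hint : Integrable (Function.uncurry G)
      ((volume : Measure (Plane × Plane)).prod (volume : Measure Plane)) := by
    rw [integrable_prod_iff hm]
    refine ⟨Eventually.of_forall fun p => (hki p.1 p.2).mul_const (g p.1 * g p.2), ?_⟩
    have e : ∀ p, ∫ z, ‖Function.uncurry G (p, z)‖ =
        c * Real.exp (-t * ‖p.1 - p.2‖ ^ 2) * ‖g p.1 * g p.2‖ := fun p => by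
      rw [← hkk, ← integral_mul_const]
      congr 1; ext z
      simp only [Function.uncurry, hG]
      rw [norm_mul, Real.norm_of_nonneg (by positivity)]
    simp_rw [e]
    refine (hgg.norm.const_mul c).mono' ?_ (Eventually.of_forall fun p => ?_)
    · refine AEStronglyMeasurable.mul (Continuous.aestronglyMeasurable (by fun_prop))
        hgg.aestronglyMeasurable.norm
    · rw [norm_mul, norm_mul, Real.norm_of_nonneg hc0.le, norm_norm, Real.norm_of_nonneg
        (Real.exp_pos _).le, mul_assoc]
      gcongr
      have : Real.exp (-t * ‖p.1 - p.2‖ ^ 2) ≤ 1 := by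
        rw [Real.exp_le_one_iff]
        have : 0 ≤ t * ‖p.1 - p.2‖ ^ 2 := by positivity
        linarith
      nlinarith [norm_nonneg (g p.1 * g p.2)]
  have hswap := integral_integral_swap hint
  have e1 : ∀ p : Plane × Plane, ∫ z, G p z =
      c * (Real.exp (-t * ‖p.1 - p.2‖ ^ 2) * (g p.1 * g p.2)) := fun p => by
    simp only [hG]
    rw [integral_mul_const, hkk, mul_assoc]
  -- Integrating over the pair first leaves a perfect square for each `z`, which is where positivity
  -- comes from.
  have e2 : ∀ z, ∫ p, G p z = (∫ x, k x z * g x) ^ 2 := fun z => by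
    rw [sq, ← integral_prod_mul (fun x => k x z * g x) (fun x => k x z * g x)]
    refine integral_congr_ae (Eventually.of_forall fun p => ?_)
    simp only [hG]
    ring
  simp_rw [e1, e2] at hswap
  rw [integral_const_mul] at hswap
  have : 0 ≤ ∫ z, (∫ x, k x z * g x) ^ 2 := integral_nonneg fun z => sq_nonneg _
  rw [← hswap] at this
  exact nonneg_of_mul_nonneg_right this hc0

theorem integrableOn_inv_mul_exp_sub_exp {a : ℝ} (ha : 0 < a) :
    IntegrableOn (fun t : ℝ => t⁻¹ * (Real.exp (-t) - Real.exp (-(a * t)))) (Set.Ioi 0) := by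
  have hm : 0 < min 1 a := by positivity
  refine Integrable.mono' (g := fun t => |a - 1| * Real.exp (-(min 1 a) * t))
    ((exp_neg_integrableOn_Ioi 0 hm).const_mul _) (Measurable.aestronglyMeasurable (by fun_prop)) ?_
  refine (ae_restrict_iff' measurableSet_Ioi).2 (Eventually.of_forall fun t ht => ?_)
  have ht' : (0:ℝ) < t := ht
  have key : ∀ u v : ℝ, u ≤ v → |Real.exp (-(u * t)) - Real.exp (-(v * t))| ≤
      (v - u) * t * Real.exp (-(u * t)) := fun u v huv => by
    have h1 : Real.exp (-(v * t)) = Real.exp (-(u * t)) * Real.exp (-((v - u) * t)) := by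
      rw [← Real.exp_add]; congr 1; ring
    have h2 := Real.add_one_le_exp (-((v - u) * t))
    have h3 : Real.exp (-((v - u) * t)) ≤ 1 := by
      rw [Real.exp_le_one_iff]; nlinarith
    have h4 := Real.exp_pos (-(u * t))
    rw [h1, abs_of_nonneg (by nlinarith)]
    nlinarith
  rw [norm_mul, norm_inv, Real.norm_of_nonneg ht'.le, inv_mul_le_iff₀ ht', Real.norm_eq_abs]
  rcases le_total 1 a with h | h
  · have := key 1 a h
    rw [one_mul] at this
    rw [min_eq_left h, abs_of_nonneg (by linarith : 0 ≤ a - 1), neg_one_mul]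
    linarith
  · have := key a 1 h
    rw [one_mul, abs_sub_comm] at this
    rw [min_eq_right h, abs_of_nonpos (by linarith : a - 1 ≤ 0), neg_mul a t]
    linarith

/-- Frullani's integral. With `a = |x - y|²` it writes `2 log |x - y|` as a superposition of
constants minus Gaussians. -/
theorem integral_inv_mul_exp_sub_exp {a : ℝ} (ha : 0 < a) :
    ∫ t in Set.Ioi (0:ℝ), t⁻¹ * (Real.exp (-t) - Real.exp (-(a * t))) = Real.log a := by
  have hf : LocallyIntegrableOn (fun t : ℝ => Real.exp (-t)) (Set.Ioi 0) :=
    (Continuous.locallyIntegrable (by fun_prop)).locallyIntegrableOn _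
  have hL : Tendsto (fun t : ℝ => Real.exp (-t)) (nhdsWithin 0 (Set.Ioi 0)) (nhds 1) := by
    have : Tendsto (fun t : ℝ => Real.exp (-t)) (nhds 0) (nhds (Real.exp (-0))) :=
      Continuous.tendsto (by fun_prop) 0
    rw [neg_zero, Real.exp_zero] at this
    exact this.mono_left nhdsWithin_le_nhds
  have h := Frullani.integral_Ioi_eq hf one_pos ha hL Real.tendsto_exp_neg_atTop_nhds_zero
    (by simpa using integrableOn_inv_mul_exp_sub_exp ha)
  simpa using h

/-- The integrand has constant sign. This gives the absolute integrability that Fubini needs from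
that of the logarithmic kernel alone. -/
theorem integral_abs_inv_mul_exp_sub_exp {a : ℝ} (ha : 0 < a) :
    ∫ t in Set.Ioi (0:ℝ), |t⁻¹ * (Real.exp (-t) - Real.exp (-(a * t)))| = |Real.log a| := by
  rcases le_total 1 a with h | h
  · rw [abs_of_nonneg (Real.log_nonneg h), ← integral_inv_mul_exp_sub_exp ha]
    refine setIntegral_congr_fun measurableSet_Ioi fun t ht => ?_
    have ht' : (0:ℝ) < t := ht
    refine abs_of_nonneg (mul_nonneg (by positivity) (sub_nonneg.2 (Real.exp_le_exp.2 ?_)))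
    nlinarith
  · rw [abs_of_nonpos (Real.log_nonpos ha.le h), ← integral_inv_mul_exp_sub_exp ha, ← integral_neg]
    refine setIntegral_congr_fun measurableSet_Ioi fun t ht => ?_
    have ht' : (0:ℝ) < t := ht
    refine abs_of_nonpos (mul_nonpos_of_nonneg_of_nonpos (by positivity)
      (sub_nonpos.2 (Real.exp_le_exp.2 ?_)))
    nlinarith

/-- The logarithmic kernel is negative definite on functions of mean zero. -/
theorem integral_log_mul_nonpos {g : Plane → ℝ} (hg : Integrable g) (hg0 : ∫ x, g x = 0)
    (hlog : Integrable (fun p : Plane × Plane => Real.log ‖p.1 - p.2‖ * (g p.1 * g p.2))) :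
    ∫ p : Plane × Plane, Real.log ‖p.1 - p.2‖ * (g p.1 * g p.2) ≤ 0 := by
  have hgg : Integrable (fun p : Plane × Plane => g p.1 * g p.2) := hg.mul_prod hg
  have hgg0 : ∫ p : Plane × Plane, g p.1 * g p.2 = 0 := by
    have := integral_prod_mul (μ := (volume : Measure Plane)) (ν := (volume : Measure Plane)) g g
    rw [hg0, zero_mul] at this
    exact this
  have hdiag : ∀ᵐ p : Plane × Plane, 0 < ‖p.1 - p.2‖ ^ 2 := by
    have : ∀ᵐ p ∂((volume : Measure Plane).prod volume), p.1 ≠ p.2 := by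
      rw [Measure.ae_prod_iff_ae_ae]
      · exact Eventually.of_forall fun x => by simp [ae_iff]
      · exact (measurableSet_eq_fun measurable_fst measurable_snd).compl
    filter_upwards [this] with p hp
    have := norm_pos_iff.2 (sub_ne_zero.2 hp)
    positivity
  set μ := (volume : Measure ℝ).restrict (Set.Ioi 0) with hμ
  set H : Plane × Plane → ℝ → ℝ := fun p t =>
    t⁻¹ * (Real.exp (-t) - Real.exp (-(‖p.1 - p.2‖ ^ 2 * t))) * (g p.1 * g p.2) with hH
  have hm : AEStronglyMeasurable (Function.uncurry H)
      ((volume : Measure (Plane × Plane)).prod μ) := by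
    refine AEStronglyMeasurable.mul (Measurable.aestronglyMeasurable ?_)
      hgg.aestronglyMeasurable.comp_fst
    fun_prop
  have hint : Integrable (Function.uncurry H) ((volume : Measure (Plane × Plane)).prod μ) := by
    rw [integrable_prod_iff hm]
    constructor
    · filter_upwards [hdiag] with p hp
      exact Integrable.mul_const (integrableOn_inv_mul_exp_sub_exp hp) (g p.1 * g p.2)
    · refine (hlog.norm.const_mul 2).congr ?_
      filter_upwards [hdiag] with p hp
      have := integral_abs_inv_mul_exp_sub_exp hp
      simp only [Function.uncurry, hH, norm_mul _ (g p.1 * g p.2), Real.norm_eq_abs] at this ⊢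
      rw [integral_mul_const, this, Real.log_pow, abs_mul, abs_mul]
      push_cast
      rw [abs_of_pos (by norm_num : (0:ℝ) < 2), mul_assoc]
  have hswap := integral_integral_swap hint
  have e1 : ∫ p, ∫ t, H p t ∂μ = 2 * ∫ p : Plane × Plane, Real.log ‖p.1 - p.2‖ * (g p.1 * g p.2) := by
    rw [← integral_const_mul]
    refine integral_congr_ae ?_
    filter_upwards [hdiag] with p hp
    have := integral_inv_mul_exp_sub_exp hp
    simp only [hH]
    rw [integral_mul_const, this, Real.log_pow]
    push_cast
    ring
  -- For each `t` the constant part integrates to `e^{-t} (∫ g)² = 0`, and the Gaussian part enters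
  -- with a minus sign.
  have e2 : ∫ t, (∫ p, H p t) ∂μ ≤ 0 := by
    refine integral_nonpos_of_ae ((ae_restrict_iff' measurableSet_Ioi).2
      (Eventually.of_forall fun t ht => ?_))
    have ht' : (0:ℝ) < t := ht
    have hi : Integrable (fun p : Plane × Plane =>
        Real.exp (-t * ‖p.1 - p.2‖ ^ 2) * (g p.1 * g p.2)) := by
      refine hgg.norm.mono' (AEStronglyMeasurable.mul (Continuous.aestronglyMeasurable
        (by fun_prop)) hgg.aestronglyMeasurable) (Eventually.of_forall fun p => ?_)
      rw [norm_mul, Real.norm_of_nonneg (Real.exp_pos _).le]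
      have : Real.exp (-t * ‖p.1 - p.2‖ ^ 2) ≤ 1 := by
        rw [Real.exp_le_one_iff]
        have : 0 ≤ t * ‖p.1 - p.2‖ ^ 2 := by positivity
        linarith
      nlinarith [norm_nonneg (g p.1 * g p.2)]
    have e : ∫ p, H p t = t⁻¹ * (Real.exp (-t) * (∫ p : Plane × Plane, g p.1 * g p.2) -
        ∫ p : Plane × Plane, Real.exp (-t * ‖p.1 - p.2‖ ^ 2) * (g p.1 * g p.2)) := by
      rw [← integral_const_mul, ← integral_sub (hgg.const_mul _) hi, ← integral_const_mul]
      congr 1; ext p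
      simp only [hH]
      rw [show -(‖p.1 - p.2‖ ^ 2 * t) = -t * ‖p.1 - p.2‖ ^ 2 by ring]
      ring
    have hpos := integral_gaussian_mul_nonneg ht' hg
    show ∫ p, H p t ≤ 0
    rw [e, hgg0, mul_zero, zero_sub]
    have : 0 < t⁻¹ := by positivity
    nlinarith
  rw [e1] at hswap
  linarith

/-! ### Strongly monotone operators and the truncated logarithm. -/

/-- A Lipschitz strongly monotone operator on a Hilbert space has a zero. -/
theorem exists_eq_zero_of_strongly_monotone {H : Type*} [NormedAddCommGroup H]
    [InnerProductSpace ℝ H] [CompleteSpace H] {T : H → H} {m L : ℝ} (hm : 0 < m)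
    (hL : ∀ x y, ‖T x - T y‖ ≤ L * ‖x - y‖)
    (hmono : ∀ x y, m * ‖x - y‖ ^ 2 ≤ inner ℝ (T x - T y) (x - y)) : ∃ x, T x = 0 := by
  set M := max L m with hM
  have hM0 : 0 < M := hm.trans_le (le_max_right _ _)
  have hML : ∀ x y, ‖T x - T y‖ ≤ M * ‖x - y‖ := fun x y =>
    (hL x y).trans (by gcongr; exact le_max_left _ _)
  -- This step minimises `1 - 2tm + t²M²`, making `x - t T x` a contraction; `M ≥ m` keeps the
  -- minimum `k` nonnegative.
  set t := m / M ^ 2 with ht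
  set k := 1 - m ^ 2 / M ^ 2 with hk
  have hk0 : 0 ≤ k := by
    rw [hk, sub_nonneg, div_le_one (by positivity)]
    gcongr; exact le_max_right _ _
  have hk1 : k < 1 := by
    have : 0 < m ^ 2 / M ^ 2 := by positivity
    rw [hk]; linarith
  set S : H → H := fun x => x - t • T x with hS
  have hSle : ∀ x y, ‖S x - S y‖ ≤ Real.sqrt k * ‖x - y‖ := by
    intro x y
    refine le_of_sq_le_sq ?_ (by positivity)
    have e : S x - S y = (x - y) - t • (T x - T y) := by
      rw [hS]; simp only [smul_sub]; abel
    rw [e, norm_sub_sq_real, inner_smul_right, norm_smul, mul_pow, mul_pow, Real.sq_sqrt hk0,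
      real_inner_comm]
    have h1 := hmono x y
    have h2 : ‖T x - T y‖ ^ 2 ≤ M ^ 2 * ‖x - y‖ ^ 2 := by
      rw [← mul_pow]; gcongr; exact hML x y
    have ht0 : 0 ≤ t := by positivity
    have h3 : t * (m * ‖x - y‖ ^ 2) ≤ t * inner ℝ (T x - T y) (x - y) :=
      mul_le_mul_of_nonneg_left h1 ht0
    have h4 : ‖t‖ ^ 2 * ‖T x - T y‖ ^ 2 ≤ t ^ 2 * (M ^ 2 * ‖x - y‖ ^ 2) := by
      rw [Real.norm_of_nonneg ht0]; gcongr
    have h5 : t * m = m ^ 2 / M ^ 2 := by rw [ht]; ring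
    have h6 : t ^ 2 * M ^ 2 = m ^ 2 / M ^ 2 := by rw [ht]; field_simp
    have h7 : ‖x - y‖ ^ 2 - 2 * (t * (m * ‖x - y‖ ^ 2)) + t ^ 2 * (M ^ 2 * ‖x - y‖ ^ 2) =
        k * ‖x - y‖ ^ 2 := by
      rw [hk]; linear_combination (-2 * ‖x - y‖ ^ 2) * h5 + ‖x - y‖ ^ 2 * h6
    linarith
  have hc : ContractingWith (Real.sqrt k).toNNReal S := by
    refine ⟨?_, LipschitzWith.of_dist_le_mul fun x y => ?_⟩
    · rw [Real.toNNReal_lt_one]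
      rw [Real.sqrt_lt' one_pos]; simpa using hk1
    · rw [dist_eq_norm, dist_eq_norm, Real.coe_toNNReal _ (Real.sqrt_nonneg _)]
      exact hSle x y
  obtain ⟨x, hfix⟩ : ∃ x, S x = x := ⟨hc.fixedPoint S, hc.fixedPoint_isFixedPt⟩
  refine ⟨x, ?_⟩
  simp only [hS, sub_eq_self] at hfix
  exact (smul_eq_zero.1 hfix).resolve_left (by positivity)

/-- `T` is compressed to `V` by orthogonal projection, so monotonicity is needed only along `V` and
the equation is solved only modulo `Vᗮ`. -/
theorem exists_mem_orthogonal_of_strongly_monotone {H : Type*} [NormedAddCommGroup H]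
    [InnerProductSpace ℝ H] [CompleteSpace H] (V : Submodule ℝ H) [CompleteSpace V] {T : H → H}
    {m L : ℝ} (hm : 0 < m) (hL : ∀ x y, ‖T x - T y‖ ≤ L * ‖x - y‖)
    (hmono : ∀ x y, x - y ∈ V → m * ‖x - y‖ ^ 2 ≤ inner ℝ (T x - T y) (x - y)) :
    ∃ x ∈ V, T x ∈ Vᗮ := by
  obtain ⟨x, hx⟩ := exists_eq_zero_of_strongly_monotone (H := V)
    (T := fun x => V.orthogonalProjectionOnto (T x)) (m := m) (L := L) hm
    (fun x y => by
      rw [← map_sub]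
      exact (V.norm_orthogonalProjectionOnto_apply_le _).trans (hL x y))
    (fun x y => by
      rw [← map_sub, Submodule.inner_orthogonalProjectionOnto_eq_of_mem_right]
      exact hmono x y (x - y).2)
  exact ⟨x, x.2, (Submodule.orthogonalProjectionOnto_eq_zero_iff).1 hx⟩

/-- The logarithm, extended linearly outside `[ε, ε⁻¹]`. -/
noncomputable def truncLog (ε t : ℝ) : ℝ :=
  Real.log (max ε (min t ε⁻¹)) + ε * (t - max ε (min t ε⁻¹))

theorem truncLog_eq_log {ε t : ℝ} (h1 : ε ≤ t) (h2 : t ≤ ε⁻¹) : truncLog ε t = Real.log t := by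
  rw [truncLog, min_eq_left h2, max_eq_right h1]; simp

/-- On `[ε, ε⁻¹]` the logarithm has slope between `ε` and `ε⁻¹`, and outside the extension has slope
`ε`. The lower bound becomes strong monotonicity, the upper one the Lipschitz constant. -/
theorem truncLog_sub_bounds {ε : ℝ} (h0 : 0 < ε) (h1 : ε ≤ 1) {a b : ℝ} (hab : a ≤ b) :
    ε * (b - a) ≤ truncLog ε b - truncLog ε a ∧ truncLog ε b - truncLog ε a ≤ ε⁻¹ * (b - a) := by
  set a' := max ε (min a ε⁻¹) with ha'
  set b' := max ε (min b ε⁻¹) with hb'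
  have hi : 1 ≤ ε⁻¹ := (one_le_inv₀ h0).2 h1
  have hε : ε ≤ ε⁻¹ := h1.trans hi
  have ha1 : ε ≤ a' := le_max_left _ _
  have hb2 : b' ≤ ε⁻¹ := max_le hε (min_le_right _ _)
  have hab' : a' ≤ b' := max_le_max le_rfl (min_le_min hab le_rfl)
  have hd : b' - a' ≤ b - a := by
    rw [ha', hb']
    rcases le_total a ε⁻¹ with h | h <;> rcases le_total b ε⁻¹ with h' | h' <;>
      simp only [min_eq_left, min_eq_right, h, h'] <;>
      rcases max_cases ε a with ⟨e, _⟩ | ⟨e, _⟩ <;> rcases max_cases ε b with ⟨e', _⟩ | ⟨e', _⟩ <;>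
      rcases max_cases ε ε⁻¹ with ⟨e'', _⟩ | ⟨e'', _⟩ <;> simp only [e, e', e''] <;> linarith
  have ha0 : 0 < a' := h0.trans_le ha1
  have hb0 : 0 < b' := ha0.trans_le hab'
  have hl1 : ε * (b' - a') ≤ Real.log b' - Real.log a' := by
    have := Real.one_sub_inv_le_log_of_pos (x := b' / a') (by positivity)
    rw [Real.log_div hb0.ne' ha0.ne', inv_div] at this
    refine le_trans ?_ this
    rw [show 1 - a' / b' = (b' - a') / b' by field_simp, le_div_iff₀ hb0]
    have : ε * b' ≤ 1 := by
      calc ε * b' ≤ ε * ε⁻¹ := by gcongr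
        _ = 1 := mul_inv_cancel₀ h0.ne'
    nlinarith
  have hl2 : Real.log b' - Real.log a' ≤ ε⁻¹ * (b' - a') := by
    have := Real.log_le_sub_one_of_pos (x := b' / a') (by positivity)
    rw [Real.log_div hb0.ne' ha0.ne'] at this
    refine this.trans ?_
    rw [show b' / a' - 1 = a'⁻¹ * (b' - a') by field_simp]
    have : a'⁻¹ ≤ ε⁻¹ := inv_anti₀ h0 ha1
    gcongr
  have e : truncLog ε b - truncLog ε a =
      (Real.log b' - Real.log a') + ε * ((b - a) - (b' - a')) := by
    simp only [truncLog, ← ha', ← hb']; ring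
  rw [e]
  constructor <;> nlinarith

theorem truncLog_strictMono {ε : ℝ} (h0 : 0 < ε) (h1 : ε ≤ 1) : StrictMono (truncLog ε) :=
  fun a b hab => by
    have := (truncLog_sub_bounds h0 h1 hab.le).1
    have : 0 < ε * (b - a) := mul_pos h0 (sub_pos.2 hab)
    linarith

theorem abs_truncLog_sub_le {ε : ℝ} (h0 : 0 < ε) (h1 : ε ≤ 1) (a b : ℝ) :
    |truncLog ε a - truncLog ε b| ≤ ε⁻¹ * |a - b| := by
  rcases le_total a b with h | h
  · have := truncLog_sub_bounds h0 h1 h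
    rw [abs_sub_comm, abs_sub_comm a b, abs_of_nonneg (sub_nonneg.2 h), abs_of_nonneg]
    · exact this.2
    · exact sub_nonneg.2 ((truncLog_strictMono h0 h1).monotone h)
  · have := truncLog_sub_bounds h0 h1 h
    rw [abs_of_nonneg (sub_nonneg.2 h), abs_of_nonneg]
    · exact this.2
    · exact sub_nonneg.2 ((truncLog_strictMono h0 h1).monotone h)

theorem le_truncLog_sub_mul_sub {ε : ℝ} (h0 : 0 < ε) (h1 : ε ≤ 1) (a b : ℝ) :
    ε * (a - b) ^ 2 ≤ (truncLog ε a - truncLog ε b) * (a - b) := by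
  rcases le_total a b with h | h
  · have := (truncLog_sub_bounds h0 h1 h).1
    nlinarith
  · have := (truncLog_sub_bounds h0 h1 h).1
    nlinarith

/-! ### The logarithmic potential on `L²(F dx)`. -/

theorem integral_withDensity_ofReal {F : Plane → ℝ} (hFm : Measurable F) (hF0 : ∀ x, 0 ≤ F x)
    (φ : Plane → ℝ) :
    ∫ x, φ x ∂(volume.withDensity fun x => ENNReal.ofReal (F x)) = ∫ x, φ x * F x := by
  rw [integral_withDensity_eq_integral_toReal_smul (by fun_prop) (by simp)]
  congr 1; ext x
  rw [ENNReal.toReal_ofReal (hF0 x), smul_eq_mul, mul_comm]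

theorem integrable_withDensity_ofReal {F : Plane → ℝ} (hFm : Measurable F) (hF0 : ∀ x, 0 ≤ F x)
    {φ : Plane → ℝ} :
    Integrable φ (volume.withDensity fun x => ENNReal.ofReal (F x)) ↔
      Integrable (fun x => φ x * F x) := by
  rw [integrable_withDensity_iff_integrable_smul' (by fun_prop) (by simp)]
  have : (fun x => (ENNReal.ofReal (F x)).toReal • φ x) = fun x => φ x * F x := by
    ext x
    rw [ENNReal.toReal_ofReal (hF0 x), smul_eq_mul, mul_comm]
  rw [this]

theorem ae_withDensity_ofReal {F : Plane → ℝ} (hFm : Measurable F) (hF0 : ∀ x, 0 ≤ F x)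
    {P : Plane → Prop} :
    (∀ᵐ x ∂(volume.withDensity fun x => ENNReal.ofReal (F x)), P x) ↔
      ∀ᵐ x, F x ≠ 0 → P x := by
  rw [ae_withDensity_iff (by fun_prop)]
  simp only [ne_eq, ENNReal.ofReal_eq_zero, not_le]
  constructor <;> intro h <;> filter_upwards [h] with x hx h'
  · exact hx (lt_of_le_of_ne (hF0 x) (Ne.symm h'))
  · exact hx h'.ne'

theorem potWeight_half_sq_le {τ s : ℝ} (x y : Plane) :
    potWeight (τ / 2) (s / 2) x y ^ 2 ≤ 2 * potWeight τ s x y := by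
  unfold potWeight
  have h1 : ((1 + ‖y‖) ^ (τ / 2)) ^ 2 = (1 + ‖y‖) ^ τ := by
    rw [← Real.rpow_mul_natCast (by positivity)]; congr 1; push_cast; ring
  have h2 : (‖x - y‖ ^ (-(s / 2))) ^ 2 = ‖x - y‖ ^ (-s) := by
    rw [← Real.rpow_mul_natCast (by positivity)]; congr 1; push_cast; ring
  rw [mul_pow, h1, ← h2]
  have : (1 + ‖x - y‖ ^ (-(s / 2))) ^ 2 ≤ 2 * (1 + (‖x - y‖ ^ (-(s / 2))) ^ 2) := by
    nlinarith [sq_nonneg (1 - ‖x - y‖ ^ (-(s / 2)))]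
  calc _ ≤ (1 + ‖y‖) ^ τ * (2 * (1 + (‖x - y‖ ^ (-(s / 2))) ^ 2)) := by gcongr
    _ = _ := by ring

/-- By the inequality between arithmetic and geometric means, weight times `|g|` is at most `g²`
plus half the squared weight; squaring doubles the exponents, hence the halves. -/
theorem PotAdmissible.mul_of_sq_integrable {τ s : ℝ} {F g : Plane → ℝ} (hF : PotAdmissible τ s F)
    (hF0 : ∀ x, 0 ≤ F x) (hg : AEStronglyMeasurable (fun x => g x * F x) volume)
    (hg2 : Integrable (fun x => g x ^ 2 * F x)) :
    PotAdmissible (τ / 2) (s / 2) (fun x => g x * F x) := by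
  obtain ⟨C, hC⟩ := hF.2
  refine ⟨hg, (∫ x, g x ^ 2 * F x) + C, fun x => ?_⟩
  have habs : ∀ y, |F y| = F y := fun y => abs_of_nonneg (hF0 y)
  have hle : ∀ y, potWeight (τ / 2) (s / 2) x y * |g y * F y| ≤
      g y ^ 2 * F y + potWeight τ s x y * |F y| := fun y => by
    rw [abs_mul, habs]
    have h1 := potWeight_half_sq_le (τ := τ) (s := s) x y
    have h2 := sq_nonneg (potWeight (τ / 2) (s / 2) x y - |g y|)
    have h3 := sq_abs (g y)
    have h4 := sq_nonneg (g y)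
    calc _ = potWeight (τ / 2) (s / 2) x y * |g y| * F y := by ring
      _ ≤ (g y ^ 2 + potWeight τ s x y) * F y := by
          refine mul_le_mul_of_nonneg_right ?_ (hF0 y)
          nlinarith
      _ = _ := by ring
  have hi : Integrable (fun y => potWeight (τ / 2) (s / 2) x y * |g y * F y|) := by
    refine (hg2.add (hC x).1).mono' ((measurable_potWeight _ _ x).aestronglyMeasurable.mul hg.norm)
      (Eventually.of_forall fun y => ?_)
    rw [Real.norm_of_nonneg (mul_nonneg (potWeight_nonneg _ _ _ _) (abs_nonneg _))]
    exact hle y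
  refine ⟨hi, (integral_mono hi (hg2.add (hC x).1) hle).trans ?_⟩
  have := integral_add hg2 (hC x).1
  simp only [Pi.add_apply] at this ⊢
  rw [this]
  gcongr
  exact (hC x).2

/-- Puts each kernel `log |x - ·|` in `L²(F dx)` with controlled growth in `x`, so that potentials
are inner products and Cauchy–Schwarz bounds them. -/
theorem PotAdmissible.log_sq_le {s : ℝ} {F : Plane → ℝ} (hF : PotAdmissible s s F) (hs : 0 < s)
    (hF0 : ∀ x, 0 ≤ F x) :
    ∃ A, 0 ≤ A ∧ ∀ x, Integrable (fun y => Real.log ‖x - y‖ ^ 2 * F y) ∧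
      ∫ y, Real.log ‖x - y‖ ^ 2 * F y ≤ (A * (1 + ‖x‖) ^ (s / 2)) ^ 2 := by
  obtain ⟨C, hC0, hC⟩ := hF.abs_integral_mul_le
  have hle : ∀ x y : Plane, |Real.log ‖x - y‖ ^ 2| ≤
      8 / s ^ 2 * (1 + ‖x‖) ^ s * potWeight s s x y := fun x y => by
    have h1 := abs_log_norm_sub_le (half_pos hs) x y
    have h2 := potWeight_half_sq_le (τ := s) (s := s) x y
    have h3 : ((1 + ‖x‖) ^ (s / 2)) ^ 2 = (1 + ‖x‖) ^ s := by
      rw [← Real.rpow_mul_natCast (by positivity)]; congr 1; push_cast; ring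
    have h4 : |Real.log ‖x - y‖| ≤ (s / 2)⁻¹ * (1 + ‖x‖) ^ (s / 2) *
      potWeight (s / 2) (s / 2) x y := h1
    rw [abs_pow]
    calc _ ≤ ((s / 2)⁻¹ * (1 + ‖x‖) ^ (s / 2) * potWeight (s / 2) (s / 2) x y) ^ 2 := by gcongr
      _ = 4 / s ^ 2 * (1 + ‖x‖) ^ s * potWeight (s / 2) (s / 2) x y ^ 2 := by
          rw [mul_pow, mul_pow, h3]; field_simp; ring
      _ ≤ 4 / s ^ 2 * (1 + ‖x‖) ^ s * (2 * potWeight s s x y) := by gcongr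
      _ = _ := by ring
  refine ⟨Real.sqrt (8 / s ^ 2 * C), by positivity, fun x => ⟨?_, ?_⟩⟩
  · exact hF.integrable_mul (Measurable.aestronglyMeasurable (by fun_prop)) x
      (Eventually.of_forall (hle x))
  · have h3 : ((1 + ‖x‖) ^ (s / 2)) ^ 2 = (1 + ‖x‖) ^ s := by
      rw [← Real.rpow_mul_natCast (by positivity)]; congr 1; push_cast; ring
    rw [mul_pow, Real.sq_sqrt (by positivity), h3]
    calc _ = ∫ y, |Real.log ‖x - y‖ ^ 2 * F y| := by
          congr 1; ext y
          rw [abs_of_nonneg (mul_nonneg (sq_nonneg _) (hF0 y))]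
      _ ≤ 8 / s ^ 2 * (1 + ‖x‖) ^ s * C :=
          hC _ _ x (by positivity) (Eventually.of_forall (hle x))
      _ = _ := by ring

/-- The logarithmic potential as an operator on `L²(F dx)`. -/
theorem exists_logPot_operator {s : ℝ} {F : Plane → ℝ} (hF : PotAdmissible s s F) (hs : 0 < s)
    (hFm : Measurable F) (hF0 : ∀ x, 0 ≤ F x) {μ : Measure Plane}
    (hμ : μ = volume.withDensity fun x => ENNReal.ofReal (F x)) :
    ∃ (N : Lp ℝ 2 μ → Lp ℝ 2 μ) (D : ℝ), 0 ≤ D ∧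
      (∀ g : Lp ℝ 2 μ, N g =ᵐ[μ] logPot fun y => g y * F y) ∧
      (∀ g g', N g - N g' = N (g - g')) ∧ (∀ g, ‖N g‖ ≤ D * ‖g‖) ∧
      ∀ g : Lp ℝ 2 μ, ∫ x, g x ∂μ = 0 → inner ℝ (N g) g ≤ 0 := by
  obtain ⟨A, hA0, hA⟩ := hF.log_sq_le hs hF0
  have hI : ∀ φ : Plane → ℝ, ∫ x, φ x ∂μ = ∫ x, φ x * F x := fun φ => by
    rw [hμ, integral_withDensity_ofReal hFm hF0]
  have hFint := hF.integrable hs.le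
  have hfin : IsFiniteMeasure μ := by
    rw [hμ]; exact isFiniteMeasure_withDensity_ofReal hFint.2
  have hgi : ∀ g : Lp ℝ 2 μ, Integrable (fun x => g x * F x) := fun g => by
    rw [← integrable_withDensity_ofReal hFm hF0, ← hμ]
    exact (Lp.memLp g).integrable one_le_two
  have hg2 : ∀ g : Lp ℝ 2 μ, Integrable (fun x => g x ^ 2 * F x) := fun g => by
    rw [← integrable_withDensity_ofReal hFm hF0 (φ := fun x => g x ^ 2), ← hμ]
    exact (Lp.memLp g).integrable_sq
  have hadm : ∀ g : Lp ℝ 2 μ, PotAdmissible (s / 2) (s / 2) (fun x => g x * F x) := fun g =>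
    hF.mul_of_sq_integrable hF0 (hgi g).aestronglyMeasurable (hg2 g)
  have hk : ∀ x, MemLp (fun y => Real.log ‖x - y‖) 2 μ := fun x => by
    have hm : Measurable fun y : Plane => Real.log ‖x - y‖ := by fun_prop
    rw [memLp_two_iff_integrable_sq hm.aestronglyMeasurable, hμ,
      integrable_withDensity_ofReal hFm hF0]
    exact (hA x).1
  have hknorm : ∀ x, ‖(hk x).toLp‖ ≤ A * (1 + ‖x‖) ^ (s / 2) := fun x => by
    refine le_of_sq_le_sq ?_ (by positivity)
    rw [← real_inner_self_eq_norm_sq, L2.inner_def]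
    refine le_trans (le_of_eq ?_) (hA x).2
    rw [← hI]
    refine integral_congr_ae ?_
    filter_upwards [(hk x).coeFn_toLp] with y hy
    rw [hy]; simp [sq]
  have hpot : ∀ (g : Lp ℝ 2 μ) x, logPot (fun y => g y * F y) x =
      (2 * Real.pi)⁻¹ * inner ℝ (hk x).toLp g := fun g x => by
    rw [logPot, L2.inner_def]
    congr 1
    calc _ = ∫ y, (Real.log ‖x - y‖ * g y) * F y := by congr 1; ext y; ring
      _ = ∫ y, Real.log ‖x - y‖ * g y ∂μ := (hI _).symm
      _ = _ := by
          refine integral_congr_ae ?_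
          filter_upwards [(hk x).coeFn_toLp] with y hy
          rw [hy]; simp [mul_comm]
  have hbd : ∀ (g : Lp ℝ 2 μ) x, |logPot (fun y => g y * F y) x| ≤
      (2 * Real.pi)⁻¹ * A * ‖g‖ * (1 + ‖x‖) ^ (s / 2) := fun g x => by
    rw [hpot, abs_mul, abs_of_nonneg (by positivity)]
    calc _ ≤ (2 * Real.pi)⁻¹ * (‖(hk x).toLp‖ * ‖g‖) := by
          gcongr; exact abs_real_inner_le_norm _ _
      _ ≤ (2 * Real.pi)⁻¹ * (A * (1 + ‖x‖) ^ (s / 2) * ‖g‖) := by gcongr; exact hknorm x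
      _ = _ := by ring
  have hmeas : ∀ g : Lp ℝ 2 μ, AEStronglyMeasurable (logPot fun y => g y * F y) volume :=
    fun g => by
      have : AEStronglyMeasurable (fun p : Plane × Plane => Real.log ‖p.1 - p.2‖ * (g p.2 * F p.2))
          (volume.prod volume) := by
        refine AEStronglyMeasurable.mul (Measurable.aestronglyMeasurable (by fun_prop)) ?_
        exact (hgi g).aestronglyMeasurable.comp_snd
      exact this.integral_prod_right'.const_mul _
  have hac : μ ≪ volume := by rw [hμ]; exact withDensity_absolutelyContinuous _ _
  -- The pointwise bound on potentials has this growth, and its square is below the weight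
  -- `potWeight s s 0`; this is what makes the operator bounded.
  have hw : MemLp (fun x : Plane => (1 + ‖x‖) ^ (s / 2)) 2 μ := by
    have hm : Measurable fun y : Plane => (1 + ‖y‖) ^ (s / 2) := by fun_prop
    rw [memLp_two_iff_integrable_sq hm.aestronglyMeasurable, hμ,
      integrable_withDensity_ofReal hFm hF0]
    refine hF.integrable_mul (c := 1) (hm.pow_const 2).aestronglyMeasurable 0
      (Eventually.of_forall fun y => ?_)
    rw [← Real.rpow_mul_natCast (by positivity)]
    push_cast
    rw [div_mul_cancel₀ _ two_ne_zero, abs_of_nonneg (by positivity), one_mul, potWeight]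
    exact le_mul_of_one_le_right (by positivity) (by
      have : 0 ≤ ‖(0 : Plane) - y‖ ^ (-s) := by positivity
      linarith)
  have hN : ∀ g : Lp ℝ 2 μ, MemLp (logPot fun y => g y * F y) 2 μ := fun g => by
    refine (hw.const_mul ((2 * Real.pi)⁻¹ * A * ‖g‖)).of_le ((hmeas g).mono_ac hac)
      (Eventually.of_forall fun x => ?_)
    rw [Real.norm_eq_abs, Real.norm_of_nonneg (by positivity)]
    exact hbd g x
  refine ⟨fun g => (hN g).toLp, (2 * Real.pi)⁻¹ * A * ‖hw.toLp‖, by positivity,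
    fun g => (hN g).coeFn_toLp, fun g g' => ?_, fun g => ?_, fun g hg => ?_⟩
  · rw [← MemLp.toLp_sub]
    refine MemLp.toLp_congr _ _ (Eventually.of_forall fun x => ?_)
    simp only [Pi.sub_apply]
    rw [hpot, hpot, hpot, ← mul_sub, inner_sub_right]
  · have : ∀ᵐ x ∂μ, ‖((hN g).toLp _) x‖ ≤ ((2 * Real.pi)⁻¹ * A * ‖g‖) * ‖(hw.toLp _) x‖ := by
      filter_upwards [(hN g).coeFn_toLp, hw.coeFn_toLp] with x h1 h2
      rw [h1, h2, Real.norm_of_nonneg (by positivity : 0 ≤ (1 + ‖x‖) ^ (s / 2))]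
      exact hbd g x
    refine (Lp.norm_le_mul_norm_of_ae_le_mul this).trans (le_of_eq (by ring))
  · have h0 : ∫ x, g x * F x = 0 := by
      rw [← hI, hg]
    have hm : AEStronglyMeasurable (fun p : Plane × Plane =>
        Real.log ‖p.1 - p.2‖ * (g p.1 * F p.1 * (g p.2 * F p.2))) (volume.prod volume) :=
      AEStronglyMeasurable.mul (Measurable.aestronglyMeasurable (by fun_prop))
        ((hgi g).mul_prod (hgi g)).aestronglyMeasurable
    obtain ⟨C, hC0, hC⟩ := (hadm g).integral_abs_log_mul_le (half_pos hs)
    have hlog : Integrable (fun p : Plane × Plane =>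
        Real.log ‖p.1 - p.2‖ * (g p.1 * F p.1 * (g p.2 * F p.2))) (volume.prod volume) := by
      rw [integrable_prod_iff hm]
      constructor
      · refine Eventually.of_forall fun x => ?_
        refine (((hadm g).integrable_log_mul (half_pos hs) x).const_mul (g x * F x)).congr
          (Eventually.of_forall fun y => ?_)
        simp only; ring
      · have hb : Integrable (fun x => C * ((1 + ‖x‖) ^ (s / 2) * |g x * F x|)) := by
          refine Integrable.const_mul ?_ C
          refine ((hadm g).integrable_mul (g := fun x => (1 + ‖x‖) ^ (s / 2)) (c := 1)
            (Measurable.aestronglyMeasurable (by fun_prop)) 0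
            (Eventually.of_forall fun y => ?_)).norm.congr (Eventually.of_forall fun y => ?_)
          · rw [abs_of_nonneg (by positivity), one_mul, potWeight]
            exact le_mul_of_one_le_right (by positivity) (by
              have : 0 ≤ ‖(0 : Plane) - y‖ ^ (-(s / 2)) := by positivity
              linarith)
          · simp only
            rw [norm_mul, Real.norm_of_nonneg (by positivity), Real.norm_eq_abs]
        refine hb.mono' hm.norm.integral_prod_right' (Eventually.of_forall fun x => ?_)
        rw [Real.norm_of_nonneg (integral_nonneg fun _ => norm_nonneg _)]
        have e : ∀ y, ‖Real.log ‖x - y‖ * (g x * F x * (g y * F y))‖ =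
            |g x * F x| * |Real.log ‖x - y‖ * (g y * F y)| := fun y => by
          rw [← abs_mul, Real.norm_eq_abs]; congr 1; ring
        simp only [e]
        rw [integral_const_mul]
        calc _ ≤ |g x * F x| * (C * (1 + ‖x‖) ^ (s / 2)) := by gcongr; exact hC x
          _ = _ := by ring
    have hneg := integral_log_mul_nonpos (hgi g) h0 hlog
    have hprod := integral_prod _ hlog
    rw [L2.inner_def]
    have e1 : ∫ x, inner ℝ (((hN g).toLp _) x) (g x) ∂μ =
        (2 * Real.pi)⁻¹ * ∫ p : Plane × Plane, Real.log ‖p.1 - p.2‖ *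
          (g p.1 * F p.1 * (g p.2 * F p.2)) := by
      calc _ = ∫ x, logPot (fun y => g y * F y) x * g x ∂μ := by
            refine integral_congr_ae ?_
            filter_upwards [(hN g).coeFn_toLp] with x hx
            rw [hx]; simp [mul_comm]
        _ = ∫ x, logPot (fun y => g y * F y) x * g x * F x := hI _
        _ = ∫ x, (2 * Real.pi)⁻¹ * ∫ y, Real.log ‖x - y‖ * (g x * F x * (g y * F y)) := by
            congr 1; ext x
            rw [logPot, mul_assoc, mul_assoc, ← integral_mul_const]
            congr 2; ext y; ring
        _ = _ := by
            rw [integral_const_mul]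
            congr 1
            exact hprod.symm
    rw [e1]
    exact mul_nonpos_of_nonneg_of_nonpos (by positivity) hneg

/-! ### Solving for the density. -/

theorem logPot_neg (h : Plane → ℝ) (x : Plane) : logPot (fun y => -h y) x = -logPot h x := by
  simp [logPot, integral_neg]

theorem logPot_congr_ae {h k : Plane → ℝ} (hk : h =ᵐ[volume] k) : logPot h = logPot k := by
  ext x
  rw [logPot, logPot]
  congr 1
  refine integral_congr_ae ?_
  filter_upwards [hk] with y hy
  rw [hy]

/-- The truncated equation: an `L²` density of mean zero solving it up to a constant. -/
theorem exists_truncated_density {s : ℝ} {F : Plane → ℝ} (hF : PotAdmissible s s F) (hs : 0 < s)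
    (hFm : Measurable F) (hF0 : ∀ x, 0 ≤ F x) {b : Plane → ℝ} (hb : Continuous b) {B₀ : ℝ}
    (hB₀ : ∀ x, |b x| ≤ B₀) (m : ℝ) {ε : ℝ} (hε0 : 0 < ε) (hε1 : ε ≤ 1) :
    ∃ (c : ℝ) (g : Plane → ℝ), AEStronglyMeasurable (fun x => g x * F x) volume ∧
      Integrable (fun x => g x ^ 2 * F x) ∧ ∫ x, g x * F x = 0 ∧
      ∀ᵐ x, F x ≠ 0 →
        2⁻¹ * truncLog ε (m + g x) = c + logPot (fun y => g y * F y) x - b x := by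
  obtain ⟨μ, hμ⟩ : ∃ μ : Measure Plane, μ = volume.withDensity fun x => ENNReal.ofReal (F x) :=
    ⟨_, rfl⟩
  obtain ⟨N, D, hD0, hN, hNsub, hNle, hNneg⟩ := exists_logPot_operator hF hs hFm hF0 hμ
  have hfin : IsFiniteMeasure μ := by
    rw [hμ]; exact isFiniteMeasure_withDensity_ofReal (hF.integrable hs.le).2
  have hI : ∀ φ : Plane → ℝ, ∫ x, φ x ∂μ = ∫ x, φ x * F x := fun φ => by
    rw [hμ, integral_withDensity_ofReal hFm hF0]
  have hIi : ∀ φ : Plane → ℝ, Integrable φ μ ↔ Integrable (fun x => φ x * F x) := fun φ => by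
    rw [hμ, integrable_withDensity_ofReal hFm hF0]
  have hae : ∀ P : Plane → Prop, (∀ᵐ x ∂μ, P x) ↔ ∀ᵐ x, F x ≠ 0 → P x := fun P => by
    rw [hμ, ae_withDensity_ofReal hFm hF0]
  -- Normalised to vanish at `0`, so that composition acts on `L²`; the subtracted constant goes
  -- back into `c` at the end.
  set θ : ℝ → ℝ := fun t => 2⁻¹ * truncLog ε (m + t) - 2⁻¹ * truncLog ε m with hθ
  have hθ0 : θ 0 = 0 := by simp [hθ]
  have hθL : LipschitzWith (2⁻¹ * ε⁻¹).toNNReal θ := by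
    refine LipschitzWith.of_dist_le_mul fun x y => ?_
    rw [Real.dist_eq, Real.dist_eq, Real.coe_toNNReal _ (by positivity)]
    have := abs_truncLog_sub_le hε0 hε1 (m + x) (m + y)
    rw [add_sub_add_left_eq_sub] at this
    have e : θ x - θ y = 2⁻¹ * (truncLog ε (m + x) - truncLog ε (m + y)) := by
      simp only [hθ]; ring
    rw [e, abs_mul, abs_of_pos (by norm_num : (0:ℝ) < 2⁻¹), mul_assoc]
    gcongr
  have hbm : MemLp b 2 μ := MemLp.of_bound hb.aestronglyMeasurable B₀ (Eventually.of_forall hB₀)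
  set T : Lp ℝ 2 μ → Lp ℝ 2 μ := fun g => hθL.compLp hθ0 g + hbm.toLp - N g with hT
  have hTsub : ∀ g g', T g - T g' = (hθL.compLp hθ0 g - hθL.compLp hθ0 g') - N (g - g') :=
    fun g g' => by rw [← hNsub]; simp only [hT]; abel
  have h1 : MemLp (fun _ : Plane => (1:ℝ)) 2 μ := memLp_const 1
  set one : Lp ℝ 2 μ := h1.toLp with hone
  have hinner : ∀ u : Lp ℝ 2 μ, inner ℝ one u = ∫ x, u x ∂μ := fun u => by
    rw [L2.inner_def]
    refine integral_congr_ae ?_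
    filter_upwards [h1.coeFn_toLp] with x hx
    rw [hone, hx]; simp
  have hmemV : ∀ u : Lp ℝ 2 μ, u ∈ (Submodule.span ℝ {one})ᗮ ↔ ∫ x, u x ∂μ = 0 := fun u => by
    rw [Submodule.mem_orthogonal_singleton_iff_inner_right, hinner]
  -- The subspace is that of mean-zero functions, on which the potential term helps monotonicity.
  -- Its orthogonal complement consists of the constants, and there the unknown `c` appears as a
  -- multiplier.
  obtain ⟨g, hgV, hgT⟩ := exists_mem_orthogonal_of_strongly_monotone
    (Submodule.span ℝ {one})ᗮ (T := T) (m := 2⁻¹ * ε) (L := (2⁻¹ * ε⁻¹) + D) (by positivity)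
    (fun g g' => by
      rw [hTsub, add_mul]
      refine (norm_sub_le _ _).trans (add_le_add ?_ (hNle _))
      have := hθL.norm_compLp_sub_le hθ0 g g'
      rwa [Real.coe_toNNReal _ (by positivity)] at this)
    (fun g g' hgg' => by
      rw [hTsub, inner_sub_left]
      have hneg := hNneg (g - g') ((hmemV _).1 hgg')
      have hθi : 2⁻¹ * ε * ‖g - g'‖ ^ 2 ≤
          inner ℝ (hθL.compLp hθ0 g - hθL.compLp hθ0 g') (g - g') := by
        rw [← real_inner_self_eq_norm_sq, L2.inner_def, L2.inner_def, ← integral_const_mul]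
        refine integral_mono_ae ((L2.integrable_inner _ _).const_mul _) (L2.integrable_inner _ _) ?_
        filter_upwards [hθL.coeFn_compLp hθ0 g, hθL.coeFn_compLp hθ0 g',
          Lp.coeFn_sub (hθL.compLp hθ0 g) (hθL.compLp hθ0 g'), Lp.coeFn_sub g g'] with x e1 e2 e3 e4
        simp only [e1, e2, e3, e4, Pi.sub_apply, Function.comp_apply, RCLike.inner_apply,
          conj_trivial, hθ]
        have := le_truncLog_sub_mul_sub hε0 hε1 (m + g x) (m + g' x)
        rw [add_sub_add_left_eq_sub] at this
        nlinarith
      linarith)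
  rw [Submodule.orthogonal_orthogonal, Submodule.mem_span_singleton] at hgT
  obtain ⟨c, hc⟩ := hgT
  refine ⟨c + 2⁻¹ * truncLog ε m, g, ?_, ?_, ?_, ?_⟩
  · exact ((hIi g).1 ((Lp.memLp g).integrable one_le_two)).aestronglyMeasurable
  · exact (hIi (fun x => g x ^ 2)).1 (Lp.memLp g).integrable_sq
  · rw [← hI]; exact (hmemV g).1 hgV
  · rw [← hae]
    have hc' : ∀ᵐ x ∂μ, (c • one : Lp ℝ 2 μ) x = T g x := by rw [hc]; simp
    filter_upwards [hc', Lp.coeFn_smul c one, h1.coeFn_toLp, hbm.coeFn_toLp, hN g,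
      hθL.coeFn_compLp hθ0 g, Lp.coeFn_sub (hθL.compLp hθ0 g + hbm.toLp) (N g),
      Lp.coeFn_add (hθL.compLp hθ0 g) hbm.toLp] with x e0 e1 e2 e3 e4 e5 e6 e7
    rw [e1, Pi.smul_apply, hone, e2] at e0
    simp only [hT] at e0
    rw [e6, Pi.sub_apply, e7, Pi.add_apply, e5, e3, e4] at e0
    simp only [Function.comp_apply, hθ, smul_eq_mul, mul_one] at e0
    linarith

/-- Existence of a density `h` of given mass with `h = F e^{2 (c + logPot h)} (1 + |x|)^{-2α}`. -/
theorem exists_density {γ s : ℝ} (hγ : 0 < γ) (hs : 0 < s) (hγs : γ + s ≤ 1) {F : Plane → ℝ}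
    (hF : PotAdmissible (γ + s) s F) (hFm : Measurable F) (hF0 : ∀ x, 0 ≤ F x)
    (hFpos : 0 < ∫ x, F x) {α : ℝ} (hα : 0 < α) :
    ∃ (c : ℝ) (h : Plane → ℝ), PotAdmissible (γ + s) s h ∧ ∫ x, h x = 2 * Real.pi * α ∧
      ∀ᵐ x, h x = F x * (Real.exp (2 * (c + logPot h x)) * (1 + ‖x‖) ^ (-(2 * α))) := by
  set m := 2 * Real.pi * α / ∫ x, F x with hm
  have hm0 : 0 < m := by have := Real.pi_pos; positivity
  have hFs := hF.mono (show s ≤ γ + s by linarith) hs.le le_rfl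
  have hmF : PotAdmissible (γ + s) s (fun x => m * F x) :=
    hF.of_abs_le (hF.1.const_mul m) m (Eventually.of_forall fun y => by
      rw [abs_mul, abs_of_pos hm0])
  have hmFs := hmF.mono (show s ≤ γ + s by linarith) hs.le le_rfl
  have hmFint : ∫ x, m * F x = 2 * Real.pi * α := by
    rw [integral_const_mul, hm, div_mul_cancel₀ _ hFpos.ne']
  set b : Plane → ℝ := fun x => α * Real.log (1 + ‖x‖) - logPot (fun x => m * F x) x with hb
  have hbc : Continuous b := by
    have := hmFs.continuous_logPot hs (by linarith)
    rw [hb]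
    fun_prop (disch := intros; positivity)
  -- The mass `2πα` of `mF` makes its potential grow like `α log (1 + |x|)`, so the two terms of `b`
  -- cancel at infinity.
  obtain ⟨B₀, hB₀⟩ : ∃ B₀, ∀ x, |b x| ≤ B₀ := by
    obtain ⟨C, hC⟩ := hmF.logPot_sub_log_one_add_le hγ hs hγs
    refine ⟨C, fun x => ?_⟩
    have := hC x
    rw [hmFint, ← mul_assoc, inv_mul_cancel₀ Real.two_pi_pos.ne', one_mul, abs_sub_comm] at this
    exact this
  have hB₀0 : 0 ≤ B₀ := (abs_nonneg _).trans (hB₀ 0)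
  -- The a priori bound to come is `|½ log (m + g) - ½ log m| ≤ 2B₀`: one `B₀` from the maximum
  -- principle, one from `b`. Since it does not involve `ε`, the truncation level can be fixed now
  -- so that `[lo, hi]` lies in `[ε, ε⁻¹]`.
  set lo := m * Real.exp (-(4 * B₀)) with hlo
  set hi := m * Real.exp (4 * B₀) with hhi
  have hlo0 : 0 < lo := by positivity
  have hhi0 : 0 < hi := by positivity
  have hlom : lo ≤ m := mul_le_of_le_one_right hm0.le (Real.exp_le_one_iff.2 (by linarith))
  have hmhi : m ≤ hi := le_mul_of_one_le_right hm0.le (Real.one_le_exp (by linarith))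
  set ε := min lo (min hi⁻¹ 1) with hε
  have hε0 : 0 < ε := by positivity
  have hε1 : ε ≤ 1 := (min_le_right _ _).trans (min_le_right _ _)
  have hεlo : ε ≤ lo := min_le_left _ _
  have hεhi : hi ≤ ε⁻¹ := by
    rw [le_inv_comm₀ hhi0 hε0]; exact (min_le_right _ _).trans (min_le_left _ _)
  obtain ⟨c, g, hgm, hg2, hg0, hg⟩ :=
    exists_truncated_density hFs hs hFm hF0 hbc hB₀ m hε0 hε1
  set k : Plane → ℝ := fun y => g y * F y with hk
  have hkadm : PotAdmissible (γ / 2 + s / 2) (s / 2) k := by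
    have := hF.mul_of_sq_integrable hF0 hgm hg2
    rwa [add_div] at this
  have hkneg : PotAdmissible (γ / 2 + s / 2) (s / 2) (fun y => -k y) :=
    hkadm.of_abs_le hkadm.1.neg 1 (Eventually.of_forall fun y => by simp)
  have hmono := truncLog_strictMono hε0 hε1
  have hθm : truncLog ε m = Real.log m := truncLog_eq_log (hεlo.trans hlom) (hmhi.trans hεhi)
  -- Where `c + logPot k` exceeds `½ log m + B₀`, the equation and monotonicity of the truncated
  -- logarithm give `g > 0`, hence `k ≥ 0`, as the maximum principle requires; the lower bound is
  -- symmetric. The alternative `g = 0` covers `k = 0` almost everywhere.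
  have hbound : ∀ᵐ x, F x ≠ 0 →
      |c + logPot k x - 2⁻¹ * Real.log m| ≤ B₀ ∨ g x = 0 := by
    have hup := logPot_max_principle hkadm (half_pos hγ) (half_pos hs) (by linarith) hg0
      (c := c) (B := 2⁻¹ * Real.log m + B₀) (by
        filter_upwards [hg] with y hy hlt
        by_cases hFy : F y = 0
        · simp [hk, hFy]
        have h1 := hy hFy
        have h2 := (abs_le.1 (hB₀ y)).2
        have h3 : truncLog ε m < truncLog ε (m + g y) := by rw [hθm]; linarith
        have h4 := hmono.lt_iff_lt.1 h3
        exact mul_nonneg (by linarith) (hF0 y))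
    have hdown := logPot_max_principle hkneg (half_pos hγ) (half_pos hs) (by linarith)
      (by rw [integral_neg, hg0, neg_zero]) (c := -c) (B := -(2⁻¹ * Real.log m) + B₀) (by
        filter_upwards [hg] with y hy hlt
        by_cases hFy : F y = 0
        · simp [hk, hFy]
        have h1 := hy hFy
        rw [logPot_neg] at hlt
        have h2 := (abs_le.1 (hB₀ y)).1
        have h3 : truncLog ε (m + g y) < truncLog ε m := by rw [hθm]; linarith
        have h4 := hmono.lt_iff_lt.1 h3
        simp only [hk, ← neg_mul]
        exact mul_nonneg (by linarith) (hF0 y))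
    have hzero : (∀ᵐ y, k y = 0) → ∀ᵐ x, F x ≠ 0 →
        |c + logPot k x - 2⁻¹ * Real.log m| ≤ B₀ ∨ g x = 0 := fun h => by
      filter_upwards [h] with x hx hFx
      exact Or.inr ((mul_eq_zero.1 hx).resolve_right hFx)
    rcases hup with hup | hup
    · rcases hdown with hdown | hdown
      · refine Eventually.of_forall fun x _ => Or.inl ?_
        have h1 := hup x
        have h2 := hdown x
        rw [logPot_neg] at h2
        rw [abs_le]; constructor <;> linarith
      · exact hzero (by filter_upwards [hdown] with x hx; simpa using hx)
    · exact hzero hup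
  have hρ : ∀ᵐ x, F x ≠ 0 → lo ≤ m + g x ∧ m + g x ≤ hi := by
    filter_upwards [hbound, hg] with x hx hgx hFx
    rcases hx hFx with h | h
    · have h1 := hgx hFx
      have h2 := abs_le.1 h
      have h3 := abs_le.1 (hB₀ x)
      have elo : truncLog ε lo = Real.log m - 4 * B₀ := by
        rw [truncLog_eq_log hεlo (hlom.trans (hmhi.trans hεhi)), hlo,
          Real.log_mul hm0.ne' (Real.exp_pos _).ne', Real.log_exp]; ring
      have ehi : truncLog ε hi = Real.log m + 4 * B₀ := by
        rw [truncLog_eq_log (hεlo.trans (hlom.trans hmhi)) hεhi, hhi,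
          Real.log_mul hm0.ne' (Real.exp_pos _).ne', Real.log_exp]
      constructor
      · rw [← hmono.le_iff_le, elo]; linarith
      · rw [← hmono.le_iff_le, ehi]; linarith
    · rw [h, add_zero]; exact ⟨hlom, hmhi⟩
  have hpot : ∀ x, logPot (fun y => (m + g y) * F y) x =
      logPot (fun y => m * F y) x + logPot k x := fun x => by
    have i1 := hmFs.integrable_log_mul hs x
    have i2 := (hkadm.mono (show s / 2 ≤ γ / 2 + s / 2 by linarith) (half_pos hs).le
      le_rfl).integrable_log_mul (half_pos hs) x
    rw [logPot, logPot, logPot, ← mul_add, ← integral_add i1 i2]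
    congr 2; ext y; simp only [hk]; ring
  have hhm : AEStronglyMeasurable (fun y => (m + g y) * F y) volume := by
    have := hmF.1.add hgm
    refine this.congr (Eventually.of_forall fun y => ?_)
    simp only [Pi.add_apply]; ring
  refine ⟨c, fun y => (m + g y) * F y, ?_, ?_, ?_⟩
  · refine hF.of_abs_le hhm hi ?_
    filter_upwards [hρ] with y hy
    by_cases hFy : F y = 0
    · simp [hFy]
    · obtain ⟨h1, h2⟩ := hy hFy
      rw [abs_mul, abs_of_nonneg (hlo0.le.trans h1)]
      gcongr
  · have i1 := hmF.integrable (by linarith)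
    have i2 := hkadm.integrable (by linarith)
    have := integral_add i1 i2
    rw [hmFint, hg0, add_zero] at this
    rw [← this]
    congr 1; ext y; simp only [hk]; ring
  · filter_upwards [hρ, hg] with x hx hgx
    by_cases hFx : F x = 0
    · simp [hFx]
    obtain ⟨h1, h2⟩ := hx hFx
    have hpos : 0 < m + g x := hlo0.trans_le h1
    have h3 := hgx hFx
    rw [truncLog_eq_log (hεlo.trans h1) (h2.trans hεhi)] at h3
    have hx0 : 0 < 1 + ‖x‖ := by positivity
    have e : m + g x = Real.exp (2 * (c + logPot (fun y => (m + g y) * F y) x)) *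
        (1 + ‖x‖) ^ (-(2 * α)) := by
      rw [Real.rpow_def_of_pos hx0, ← Real.exp_add, ← Real.exp_log hpos]
      congr 1
      rw [hpot]
      simp only [hb] at h3
      linarith
    calc (m + g x) * F x = F x * (m + g x) := mul_comm _ _
      _ = _ := by rw [← e]

/-! ### From the exponents of `K` to admissibility and growth bounds. -/

theorem exists_integrable_of_lt_alphaExp {K : Plane → ℝ} (hK : AEMeasurable K volume) {p : ℝ}
    {z : EReal} (hz : z < alphaExp K p) :
    ∃ a : ℝ, z < a ∧ Integrable fun x => |K x| ^ p * (1 + ‖x‖) ^ (2 * a * p + 2 * (p - 1)) := by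
  obtain ⟨_, ⟨a, ha, rfl⟩, hza⟩ := lt_sSup_iff.1 hz
  refine ⟨a, hza, ?_⟩
  have hm : AEStronglyMeasurable
      (fun x : Plane => |K x| ^ p * (1 + ‖x‖) ^ (2 * a * p + 2 * (p - 1))) volume :=
    ((hK.norm.pow_const p).mul (Measurable.aemeasurable (by fun_prop))).aestronglyMeasurable
  refine ⟨hm, ?_⟩
  rw [hasFiniteIntegral_iff_ofReal (Eventually.of_forall fun x => by positivity)]
  exact ha

theorem exists_potAdmissible_of_lt_alphaExp {K : Plane → ℝ} (hK : AEMeasurable K volume)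
    (hp : ∃ p : ℝ, 1 < p ∧ ⊥ < alphaExp K p) {α β γ : ℝ}
    (hβ : ((α + β : ℝ) : EReal) < alphaExp K 1) (hγβ : γ < 2 * β) (hγ1 : γ < 1) :
    ∃ s, 0 < s ∧ γ + s ≤ 1 ∧ PotAdmissible (γ + s) s (fun y => |K y| * (1 + ‖y‖) ^ (2 * α)) := by
  obtain ⟨p, hp1, hp⟩ := hp
  obtain ⟨a, ha, hai⟩ := exists_integrable_of_lt_alphaExp hK hβ
  obtain ⟨a', -, hai'⟩ := exists_integrable_of_lt_alphaExp hK hp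
  have ha' : α + β < a := by exact_mod_cast ha
  -- The room left after `γ`: `γ + s₁ ≤ 2β` keeps the total weight `2α + γ + s₁` below `2a`, and `γ
  -- + s₁ ≤ 1` is the range of the kernel estimates.
  set s₁ := min (2 * β - γ) (1 - γ) with hs₁
  have hs₁0 : 0 < s₁ := lt_min (by linarith) (by linarith)
  have h1 : s₁ ≤ 2 * β - γ := min_le_left _ _
  have h2 : s₁ ≤ 1 - γ := min_le_right _ _
  have hB : Integrable (fun x : Plane => |K x| * (1 + ‖x‖) ^ (2 * a)) := by
    simpa using hai
  obtain ⟨s₀, hs₀, h⟩ := exists_potAdmissible (κ := 2 * α) (τ := γ + s₁) hK hp1 hB hai'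
    (by linarith)
  have hs : 0 < min s₀ s₁ := by positivity
  refine ⟨min s₀ s₁, hs, by linarith [min_le_right s₀ s₁], ?_⟩
  exact (h _ hs.le (min_le_left _ _)).mono (by linarith [min_le_right s₀ s₁]) hs.le le_rfl

theorem exists_abs_sub_log_one_add_le {α : ℝ} {v : Plane → ℝ} (hv : Continuous v)
    (hg : HasLogGrowth α v) : ∃ C, ∀ x, |v x - α * Real.log (1 + ‖x‖)| ≤ C := by
  obtain ⟨C, hC⟩ := hg.bound
  rw [← Metric.cobounded_eq_cocompact, ← comap_norm_atTop, eventually_comap] at hC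
  obtain ⟨R, hR⟩ := (hC.and (eventually_ge_atTop 1)).exists_forall_of_atTop
  have hc : Continuous (fun x => |v x - α * Real.log (1 + ‖x‖)|) := by
    fun_prop (disch := intros; positivity)
  obtain ⟨D, hD⟩ := (isCompact_closedBall (0 : Plane) R).bddAbove_image hc.continuousOn
  refine ⟨max D (C + |α| * Real.log 2), fun x => ?_⟩
  rcases le_total ‖x‖ R with h1 | h1
  · exact (hD ⟨x, by simpa using h1, rfl⟩).trans (le_max_left _ _)
  · refine le_trans ?_ (le_max_right _ _)
    obtain ⟨h2, h3⟩ := hR ‖x‖ h1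
    have h2' := h2 x rfl
    rw [norm_one, mul_one, Real.norm_eq_abs] at h2'
    have hx0 : 0 < ‖x‖ := by linarith
    have h4 : |Real.log ‖x‖ - Real.log (1 + ‖x‖)| ≤ Real.log 2 := by
      have a1 := Real.log_le_log hx0 (show ‖x‖ ≤ 1 + ‖x‖ by linarith)
      have a2 := Real.log_le_log (by positivity) (show 1 + ‖x‖ ≤ 2 * ‖x‖ by linarith)
      rw [Real.log_mul (by norm_num) hx0.ne'] at a2
      have := Real.log_nonneg (show (1:ℝ) ≤ 2 by norm_num)
      rw [abs_le]; constructor <;> linarith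
    calc _ = |(v x - α * Real.log ‖x‖) + α * (Real.log ‖x‖ - Real.log (1 + ‖x‖))| := by
          congr 1; ring
      _ ≤ C + |α| * |Real.log ‖x‖ - Real.log (1 + ‖x‖)| := by
          refine (abs_add_le _ _).trans ?_
          rw [abs_mul]; gcongr
      _ ≤ _ := by gcongr

/-- The density `|K| e^{2v}` is admissible when `v` grows like `α ln |x|`. -/
theorem potAdmissible_abs_mul_exp {τ s α C : ℝ} {K v : Plane → ℝ} (hK : AEMeasurable K volume)
    (hF : PotAdmissible τ s (fun y => |K y| * (1 + ‖y‖) ^ (2 * α))) (hv : Continuous v)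
    (hC : ∀ x, |v x - α * Real.log (1 + ‖x‖)| ≤ C) :
    PotAdmissible τ s (fun y => |K y| * Real.exp (2 * v y)) := by
  have hm : AEStronglyMeasurable (fun y => |K y| * Real.exp (2 * v y)) volume :=
    hK.norm.aestronglyMeasurable.mul (Continuous.aestronglyMeasurable (by fun_prop))
  refine hF.of_abs_le hm (Real.exp (2 * C)) (Eventually.of_forall fun y => ?_)
  have hy0 : 0 < 1 + ‖y‖ := by positivity
  have h1 : Real.exp (2 * v y) ≤ Real.exp (2 * C) * (1 + ‖y‖) ^ (2 * α) := by
    rw [Real.rpow_def_of_pos hy0, ← Real.exp_add, Real.exp_le_exp]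
    have := (abs_le.1 (hC y)).2
    linarith
  rw [abs_of_nonneg (by positivity : 0 ≤ |K y| * Real.exp (2 * v y)),
    abs_of_nonneg (by positivity : 0 ≤ |K y| * (1 + ‖y‖) ^ (2 * α))]
  calc _ ≤ |K y| * (Real.exp (2 * C) * (1 + ‖y‖) ^ (2 * α)) := by gcongr
    _ = _ := by ring

theorem isLittleO_rpow_neg_rpow_neg {a b : ℝ} (hab : a < b) :
    (fun r : ℝ => r ^ (-b)) =o[atTop] fun r : ℝ => r ^ (-a) := by
  refine isLittleO_of_tendsto' ?_ ((tendsto_rpow_neg_atTop (sub_pos.2 hab)).congr' ?_)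
  · filter_upwards [eventually_gt_atTop 0] with r hr h
    exact absurd h (Real.rpow_pos_of_pos hr _).ne'
  · filter_upwards [eventually_gt_atTop 0] with r hr
    rw [← Real.rpow_sub hr]
    congr 1
    ring

theorem eq_zero_of_abs_mul_log_le {a C : ℝ} (h : ∀ x : Plane, |a * Real.log (1 + ‖x‖)| ≤ C) :
    a = 0 := by
  by_contra ha
  have hlim : Tendsto (fun r : ℝ => |a| * Real.log (1 + r)) atTop atTop :=
    (Real.tendsto_log_atTop.comp (tendsto_atTop_add_const_left _ _ tendsto_id)).const_mul_atTop
      (abs_pos.2 ha)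
  obtain ⟨r, hr1, hr0⟩ := ((hlim.eventually_gt_atTop C).and (eventually_ge_atTop 0)).exists
  have h1 := h (planeIso r)
  rw [planeIso.norm_map, Complex.norm_real, Real.norm_of_nonneg hr0, abs_mul,
    abs_of_nonneg (Real.log_nonneg (by linarith))] at h1
  linarith

/-! ### Representation, uniqueness and existence of solutions. -/

/-- Solutions of logarithmic growth are given by their logarithmic potential, and their total
curvature is determined by their growth. -/
theorem IsCurvatureSolution.eq_logPot {α γ s C : ℝ} (hγ : 0 < γ) (hs : 0 < s) (hγs : γ + s ≤ 1)
    {K v : Plane → ℝ} (hK : ∀ᵐ x, K x ≤ 0) (hv : IsCurvatureSolution K v)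
    (hadm : PotAdmissible (γ + s) s (fun y => |K y| * Real.exp (2 * v y)))
    (hC : ∀ x, |v x - α * Real.log (1 + ‖x‖)| ≤ C) :
    (∃ c, ∀ x, v x = c + logPot (fun y => |K y| * Real.exp (2 * v y)) x) ∧
      ∫ y, |K y| * Real.exp (2 * v y) = 2 * Real.pi * α := by
  set h : Plane → ℝ := fun y => |K y| * Real.exp (2 * v y) with hh
  have hadm' := hadm.mono (show s ≤ γ + s by linarith) hs.le le_rfl
  have hpc := hadm'.continuous_logPot hs (by linarith)
  obtain ⟨D, hD⟩ := hadm.logPot_sub_log_one_add_le hγ hs hγs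
  set m := (2 * Real.pi)⁻¹ * ∫ y, h y with hm
  have hw : Continuous fun x => v x - logPot h x := hv.continuous.sub hpc
  have hrep : ∀ x, v x = (v 0 - logPot h 0) + logPot h x := by
    intro x
    have hweak : ∀ φ : Plane → ℝ, ContDiff ℝ ∞ φ → HasCompactSupport φ →
        ∫ x, (v x - logPot h x) * Laplacian.laplacian φ x = 0 := by
      intro φ hφ hc
      have hg := continuous_laplacian hφ
      have hgc := hc.laplacian
      have i1 : Integrable fun x => v x * Laplacian.laplacian φ x :=
        (hv.continuous.mul hg).integrable_of_hasCompactSupport hgc.mul_left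
      have i2 : Integrable fun x => logPot h x * Laplacian.laplacian φ x :=
        (hpc.mul hg).integrable_of_hasCompactSupport hgc.mul_left
      simp_rw [sub_mul]
      rw [integral_sub i1 i2, integral_logPot_mul_laplacian hadm' hs hφ hc]
      have h1 := hv.weak φ hφ hc
      have h2 : ∫ x, K x * Real.exp (2 * v x) * φ x = -∫ y, h y * φ y := by
        rw [← integral_neg]
        refine integral_congr_ae ?_
        filter_upwards [hK] with y hy
        simp only [hh]
        rw [abs_of_nonpos hy]; ring
      linarith
    have hgrow : ∀ x, v x - logPot h x ≤
        (|α| + |m| + |C| + |D| + 1) * (1 + Real.log (1 + ‖x‖)) := by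
      intro x
      have h1 := (abs_le.1 (hC x)).2
      have h2 := (abs_le.1 (hD x)).1
      have h3 := Real.log_nonneg (show 1 ≤ 1 + ‖x‖ by linarith [norm_nonneg x])
      set l := Real.log (1 + ‖x‖)
      have h4 : α * l ≤ |α| * l := mul_le_mul_of_nonneg_right (le_abs_self _) h3
      have h5 : -(m * l) ≤ |m| * l := by
        rw [← neg_mul]; exact mul_le_mul_of_nonneg_right (neg_le_abs _) h3
      have h6 := le_abs_self C
      have h7 := le_abs_self D
      nlinarith [abs_nonneg α, abs_nonneg m, abs_nonneg C, abs_nonneg D,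
        mul_nonneg (abs_nonneg C) h3, mul_nonneg (abs_nonneg D) h3]
    have := eq_of_weakly_harmonic hw hweak (by positivity) hgrow x 0
    linarith
  refine ⟨⟨_, hrep⟩, ?_⟩
  -- Both `v - α log (1 + |x|)` and `logPot h - m log (1 + |x|)` are bounded, and `v - logPot h` is
  -- constant, so the logarithmic coefficients agree.
  have hzero : α - m = 0 := by
    refine eq_zero_of_abs_mul_log_le (C := C + D + |v 0 - logPot h 0|) fun x => ?_
    have e : (α - m) * Real.log (1 + ‖x‖) = -(v x - α * Real.log (1 + ‖x‖)) +
        (logPot h x - m * Real.log (1 + ‖x‖)) + (v 0 - logPot h 0) := by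
      have := hrep x
      linear_combination this
    rw [e]
    refine (abs_add_le _ _).trans (add_le_add ((abs_add_le _ _).trans (add_le_add ?_ (hD x))) le_rfl)
    rw [abs_neg]; exact hC x
  have : m = α := by linarith
  rw [← this, hm, mul_inv_cancel_left₀ Real.two_pi_pos.ne']

/-- Both densities have mass `2πα`, so their difference `h` has mean zero, and it is nonnegative
wherever `u > v` because `exp` is increasing. The maximum principle at level `0`, for `h` and `-h`,
gives both inequalities. -/
theorem IsCurvatureSolution.unique {α γ s : ℝ} (hγ : 0 < γ) (hs : 0 < s) (hγs : γ + s ≤ 1)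
    {K u v : Plane → ℝ} (hKm : AEMeasurable K volume) (hK : ∀ᵐ x, K x ≤ 0)
    (hK0 : ¬ ∀ᵐ x, K x = 0)
    (hF : PotAdmissible (γ + s) s (fun y => |K y| * (1 + ‖y‖) ^ (2 * α)))
    (hu : IsCurvatureSolution K u) (hug : HasLogGrowth α u)
    (hv : IsCurvatureSolution K v) (hvg : HasLogGrowth α v) : u = v := by
  obtain ⟨C, hC⟩ := exists_abs_sub_log_one_add_le hu.continuous hug
  obtain ⟨D, hD⟩ := exists_abs_sub_log_one_add_le hv.continuous hvg
  have hadu := potAdmissible_abs_mul_exp hKm hF hu.continuous hC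
  have hadv := potAdmissible_abs_mul_exp hKm hF hv.continuous hD
  obtain ⟨⟨c, hc⟩, hcm⟩ := hu.eq_logPot hγ hs hγs hK hadu hC
  obtain ⟨⟨d, hd⟩, hdm⟩ := hv.eq_logPot hγ hs hγs hK hadv hD
  set h : Plane → ℝ := fun y => |K y| * Real.exp (2 * u y) - |K y| * Real.exp (2 * v y) with hh
  have hadm : PotAdmissible (γ + s) s h := hadu.sub hadv
  have hneg : PotAdmissible (γ + s) s (fun y => -h y) :=
    hadm.of_abs_le hadm.1.neg 1 (Eventually.of_forall fun y => by simp)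
  have hint : ∫ y, h y = 0 := by
    have := integral_sub (hadu.integrable (by linarith)) (hadv.integrable (by linarith))
    rw [hcm, hdm, sub_self] at this
    exact this
  have hdiff : ∀ x, u x - v x = (c - d) + logPot h x := fun x => by
    have i1 := (hadu.mono (show s ≤ γ + s by linarith) hs.le le_rfl).integrable_log_mul hs x
    have i2 := (hadv.mono (show s ≤ γ + s by linarith) hs.le le_rfl).integrable_log_mul hs x
    have e : logPot h x = logPot (fun y => |K y| * Real.exp (2 * u y)) x -
        logPot (fun y => |K y| * Real.exp (2 * v y)) x := by
      rw [logPot, logPot, logPot, ← mul_sub, ← integral_sub i1 i2]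
      congr 2; ext y; simp only [hh]; ring
    rw [hc x, hd x, e]; ring
  -- In the degenerate alternative `u - v` is constant, and a point where `K ≠ 0` and `h = 0` shows
  -- that the constant is `0`.
  have hzero : (∀ᵐ y, h y = 0) → u = v := by
    intro h0
    have hp0 : logPot h = logPot (fun _ => 0) := logPot_congr_ae h0
    have hp0' : ∀ x, logPot h x = 0 := fun x => by rw [hp0]; simp [logPot]
    obtain ⟨y, hy0, hyK⟩ : ∃ y, h y = 0 ∧ K y ≠ 0 := by
      by_contra! hcon
      exact hK0 (h0.mono hcon)
    have h1 : Real.exp (2 * u y) = Real.exp (2 * v y) := by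
      have : |K y| * (Real.exp (2 * u y) - Real.exp (2 * v y)) = 0 := by
        rw [mul_sub]; exact hy0
      exact sub_eq_zero.1 ((mul_eq_zero.1 this).resolve_left (abs_ne_zero.2 hyK))
    have h2 := Real.exp_injective h1
    have h3 := hdiff y
    rw [hp0'] at h3
    ext x
    have h4 := hdiff x
    rw [hp0'] at h4
    linarith
  have hup := logPot_max_principle hadm hγ hs hγs hint (c := c - d) (B := 0)
    (Eventually.of_forall fun y hy => by
      rw [← hdiff] at hy
      have := Real.exp_le_exp.2 (show 2 * v y ≤ 2 * u y by linarith)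
      exact sub_nonneg.2 (mul_le_mul_of_nonneg_left this (abs_nonneg _)))
  have hdown := logPot_max_principle hneg hγ hs hγs (by rw [integral_neg, hint, neg_zero])
    (c := -(c - d)) (B := 0)
    (Eventually.of_forall fun y hy => by
      rw [logPot_neg, ← neg_add, ← hdiff] at hy
      have := Real.exp_le_exp.2 (show 2 * u y ≤ 2 * v y by linarith)
      simp only [hh, neg_sub]
      exact sub_nonneg.2 (mul_le_mul_of_nonneg_left this (abs_nonneg _)))
  rcases hup with hup | hup
  · rcases hdown with hdown | hdown
    · ext x
      have h1 := hup x
      have h2 := hdown x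
      rw [← hdiff] at h1
      rw [logPot_neg, ← neg_add, ← hdiff] at h2
      linarith
    · exact hzero (by filter_upwards [hdown] with x hx; simpa using hx)
  · exact hzero hup

theorem integral_laplacian_eq_zero {φ : Plane → ℝ} (hφ : ContDiff ℝ ∞ φ)
    (hc : HasCompactSupport φ) : ∫ x, Laplacian.laplacian φ x = 0 := by
  have := integral_mul_laplacian (f := fun _ : Plane => (1:ℝ)) contDiff_const hφ hc
  simpa using this

/-- Existence of a solution given by a logarithmic potential. -/
theorem exists_curvatureSolution {α γ s : ℝ} (hα : 0 < α) (hγ : 0 < γ) (hs : 0 < s)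
    (hγs : γ + s ≤ 1) {K : Plane → ℝ} (hKm : AEMeasurable K volume) (hK : ∀ᵐ x, K x ≤ 0)
    (hK0 : ¬ ∀ᵐ x, K x = 0)
    (hF : PotAdmissible (γ + s) s (fun y => |K y| * (1 + ‖y‖) ^ (2 * α))) :
    ∃ (u : Plane → ℝ) (c : ℝ), IsCurvatureSolution K u ∧ HasLogGrowth α u ∧
      (∀ x, u x = c + logPot (fun y => |K y| * Real.exp (2 * u y)) x) ∧
      ∫ y, |K y| * Real.exp (2 * u y) = 2 * Real.pi * α := by
  -- A Borel representative of `K` makes the weight `F` genuinely measurable, as the density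
  -- construction demands.
  set K' := hKm.mk K with hK'
  have hKK' : K =ᵐ[volume] K' := hKm.ae_eq_mk
  have hK'm : Measurable K' := hKm.measurable_mk
  set F : Plane → ℝ := fun y => |K' y| * (1 + ‖y‖) ^ (2 * α) with hFdef
  have hFm : Measurable F := by
    rw [hFdef]
    exact hK'm.norm.mul (by fun_prop)
  have hF0 : ∀ x, 0 ≤ F x := fun x => by rw [hFdef]; positivity
  have hFadm : PotAdmissible (γ + s) s F := by
    refine hF.of_abs_le hFm.aestronglyMeasurable 1 ?_
    filter_upwards [hKK'] with y hy
    simp only [hFdef, hy, one_mul, le_refl]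
  have hFpos : 0 < ∫ x, F x := by
    refine lt_of_le_of_ne (integral_nonneg hF0) fun h => hK0 ?_
    have := (integral_eq_zero_iff_of_nonneg_ae (Eventually.of_forall hF0)
      (hFadm.integrable (by linarith))).1 h.symm
    filter_upwards [this, hKK'] with y hy hKy
    have h1 : (1 + ‖y‖) ^ (2 * α) ≠ 0 := by positivity
    rw [hKy]
    exact abs_eq_zero.1 ((mul_eq_zero.1 hy).resolve_right h1)
  obtain ⟨c, h, hadm, hmass, hh⟩ := exists_density hγ hs hγs hFadm hFm hF0 hFpos hα
  have hadm' := hadm.mono (show s ≤ γ + s by linarith) hs.le le_rfl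
  set u : Plane → ℝ := fun x => c + logPot h x with hu
  have hpc := hadm'.continuous_logPot hs (by linarith)
  have hhK : h =ᵐ[volume] fun y => |K y| * Real.exp (2 * u y) := by
    filter_upwards [hh, hKK'] with y hy hKy
    have hy0 : 0 < 1 + ‖y‖ := by positivity
    rw [hy, hKy]
    simp only [hFdef]
    rw [Real.rpow_neg hy0.le]
    field_simp
    rfl
  refine ⟨u, c, ⟨continuous_const.add hpc, fun φ hφ hc => ?_⟩, ?_, fun x => ?_, ?_⟩
  · have hg := continuous_laplacian hφ
    have hgc := hc.laplacian
    have i1 : Integrable fun x => c * Laplacian.laplacian φ x :=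
      (hg.integrable_of_hasCompactSupport hgc).const_mul c
    have i2 : Integrable fun x => logPot h x * Laplacian.laplacian φ x :=
      (hpc.mul hg).integrable_of_hasCompactSupport hgc.mul_left
    have e1 : ∫ x, u x * Laplacian.laplacian φ x = ∫ y, h y * φ y := by
      simp only [hu, add_mul]
      rw [integral_add i1 i2, integral_const_mul, integral_laplacian_eq_zero hφ hc,
        integral_logPot_mul_laplacian hadm' hs hφ hc]
      ring
    have e2 : ∫ x, K x * Real.exp (2 * u x) * φ x = -∫ y, h y * φ y := by
      rw [← integral_neg]
      refine integral_congr_ae ?_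
      filter_upwards [hK, hhK] with y hy1 hy2
      rw [hy2, abs_of_nonpos hy1]; ring
    rw [e1, e2]; ring
  · obtain ⟨C, hC0, hC⟩ := hadm.logPot_sub_log_le hγ hs hγs
    refine IsBigO.of_bound (|c| + C) ?_
    have hev : ∀ᶠ x : Plane in cocompact Plane, 1 ≤ ‖x‖ :=
      tendsto_norm_cocompact_atTop.eventually_ge_atTop 1
    filter_upwards [hev] with x hx
    have hx0 : x ≠ 0 := norm_pos_iff.1 (by linarith)
    have h1 := hC x hx0
    rw [hmass, inv_mul_cancel_left₀ Real.two_pi_pos.ne'] at h1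
    rw [norm_one, mul_one, Real.norm_eq_abs]
    have h2 : ‖x‖ ^ (-γ) ≤ 1 := Real.rpow_le_one_of_one_le_of_nonpos hx (by linarith)
    calc |u x - α * Real.log ‖x‖| = |c + (logPot h x - α * Real.log ‖x‖)| := by
          congr 1; simp only [hu]; ring
      _ ≤ |c| + |logPot h x - α * Real.log ‖x‖| := abs_add_le _ _
      _ ≤ |c| + C * 1 := by
          gcongr
          refine le_trans ?_ (h1.trans (by gcongr))
          exact le_rfl
      _ = _ := by ring
  · rw [← logPot_congr_ae hhK]
  · rw [← integral_congr_ae hhK]; exact hmass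

/-! ### The main theorem. -/

theorem theorem1p1 (K : Plane → ℝ)
    (hK_meas : AEMeasurable K volume)
    (hK_nonpos : ∀ᵐ x : Plane, K x ≤ 0)
    (hK_nontriv : ¬ (∀ᵐ x : Plane, K x = 0))
    (hK_bdd : IsLocBounded K)
    (h1 : 0 < alphaExp K 1)
    (hp : ∃ p : ℝ, 1 < p ∧ ⊥ < alphaExp K p)
    (α : ℝ) (hα_pos : 0 < α) (hα_lt : (α : EReal) < alphaExp K 1) :
    ∃ u : Plane → ℝ,
      (IsCurvatureSolution K u ∧ HasLogGrowth α u) ∧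
      (∀ v : Plane → ℝ, IsCurvatureSolution K v → HasLogGrowth α v → v = u) ∧
      (Integrable (fun x : Plane => K x * Real.exp (2 * u x)) volume ∧
        ∫ x : Plane, K x * Real.exp (2 * u x) = -(2 * α * Real.pi)) ∧
      ∃ c : ℝ, ∀ β : ℝ, 0 < β → (β : EReal) < alphaExp K 1 - (α : EReal) →
        (fun x : Plane => u x - α * Real.log ‖x‖ - c)
          =o[cocompact Plane] (fun x : Plane => ‖x‖ ^ (-(2 * β / (1 + 2 * β)))) := by
  obtain ⟨a, ha, ha'⟩ := EReal.lt_iff_exists_real_btwn.1 hα_lt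
  have ha0 : α < a := by exact_mod_cast ha
  -- Any small decay exponent suffices for existence and uniqueness; the sharper ones are extracted
  -- below for each `β` from the same `u` and `c`.
  obtain ⟨γ, hγ0, hγ⟩ := exists_between (show (0:ℝ) < min (2 * (a - α)) 1 from
    lt_min (by linarith) one_pos)
  obtain ⟨s, hs, hγs, hF⟩ := exists_potAdmissible_of_lt_alphaExp hK_meas hp (α := α) (β := a - α)
    (by rwa [add_sub_cancel]) (hγ.trans_le (min_le_left _ _)) (hγ.trans_le (min_le_right _ _))
  obtain ⟨u, c, hu, hug, hrep, hmass⟩ :=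
    exists_curvatureSolution hα_pos hγ0 hs hγs hK_meas hK_nonpos hK_nontriv hF
  obtain ⟨C, hC⟩ := exists_abs_sub_log_one_add_le hu.continuous hug
  have hadm := potAdmissible_abs_mul_exp hK_meas hF hu.continuous hC
  have hae : (fun y => -(|K y| * Real.exp (2 * u y))) =ᵐ[volume]
      fun y => K y * Real.exp (2 * u y) := by
    filter_upwards [hK_nonpos] with y hy
    rw [abs_of_nonpos hy]; ring
  refine ⟨u, ⟨hu, hug⟩, fun v hv hvg => hv.unique hγ0 hs hγs hK_meas hK_nonpos hK_nontriv hF hvg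
    hu hug, ⟨(hadm.integrable (by linarith)).neg.congr hae, ?_⟩, c, fun β hβ0 hβ => ?_⟩
  · rw [← integral_congr_ae hae, integral_neg, hmass]; ring
  · have hαβ : ((α + β : ℝ) : EReal) < alphaExp K 1 := by
      rw [EReal.coe_add, add_comm]
      exact (EReal.lt_sub_iff_add_lt (Or.inl (EReal.coe_ne_bot _))
        (Or.inl (EReal.coe_ne_top _))).1 hβ
    have h12 : 0 < 1 + 2 * β := by positivity
    have hlt : 2 * β / (1 + 2 * β) < min (2 * β) 1 := by
      refine lt_min ?_ ?_
      · rw [div_lt_iff₀ h12]; nlinarith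
      · rw [div_lt_one h12]; linarith
    -- A rate strictly faster than the required one: the potential estimate gives `O(|x|^{-δ})`, and
    -- the strict inequality upgrades it to little-o.
    obtain ⟨δ, hδ1, hδ⟩ := exists_between hlt
    have hδ0 : 0 < δ := lt_trans (by positivity) hδ1
    obtain ⟨t, ht, hδt, hFt⟩ := exists_potAdmissible_of_lt_alphaExp hK_meas hp hαβ
      (hδ.trans_le (min_le_left _ _)) (hδ.trans_le (min_le_right _ _))
    have hadmt := potAdmissible_abs_mul_exp hK_meas hFt hu.continuous hC
    obtain ⟨D, hD0, hD⟩ := hadmt.logPot_sub_log_le hδ0 ht hδt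
    have hO : (fun x : Plane => u x - α * Real.log ‖x‖ - c) =O[cocompact Plane]
        (fun x : Plane => ‖x‖ ^ (-δ)) := by
      refine IsBigO.of_bound D ?_
      have hev : ∀ᶠ x in cocompact Plane, x ≠ 0 :=
        (isCompact_singleton (x := (0 : Plane))).compl_mem_cocompact
      filter_upwards [hev] with x hx
      have h2 := hD x hx
      rw [hmass, inv_mul_cancel_left₀ Real.two_pi_pos.ne'] at h2
      rw [Real.norm_eq_abs, Real.norm_of_nonneg (by positivity)]
      refine le_trans (le_of_eq ?_) h2
      congr 1
      rw [hrep x]; ring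
    refine hO.trans_isLittleO ?_
    have hlo : (fun r : ℝ => r ^ (-δ)) =o[atTop] fun r : ℝ => r ^ (-(2 * β / (1 + 2 * β))) :=
      isLittleO_rpow_neg_rpow_neg (by linarith)
    exact hlo.comp_tendsto tendsto_norm_cocompact_atTop
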